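/- Let $\mathcal H\subset[0,1]^{\mathcal X}$ be a nonempty class of functions on a measurable space $\mathcal X$, let the loss be the absolute loss $|\hat y-y|$, and let $\mathsf{Rad}_T(\mathcal H)=\sup_{x\in\mathcal X^T}\mathbb E_{\epsilon}\big[\sup_{h\in\mathcal H}\sum_{t=1}^T\epsilon_t h(x_t)\big]$, with $\epsilon$ uniform on $\{\pm1\}^T$. A prediction rule $\Phi$ maps $(x_1,\dots,x_t,y_1,\dots,y_{t-1})\in\mathcal X^t\times[0,1]^{t-1}$, for every $t\ge1$, to a probability distribution on $[0,1]$. Its oblivious minimax regret at horizon $T$ is $$\tilde r^{\mathsf{ob}}_T(\mathcal H,\Phi)=\sup_{f_1,\dots,f_T}\ \sup_{\mu}\ \mathbb E_{x_1,\dots,x_T\sim\mu\ \text{i.i.d.}}\ \mathbb E_{\hat y_1,\dots,\hat y_T}\Big[\sum_{t=1}^T|\hat y_t-f_t(x_t)|-\inf_{h\in\mathcal H}\sum_{t=1}^T|h(x_t)-f_t(x_t)|\Big],$$ where the $f_t:\mathcal X\to[0,1]$ are measurable, $\mu$ ranges over the probability distributions on $\mathcal X$, and $\hat y_t\sim\Phi(x_1,\dots,x_t,f_1(x_1),\dots,f_{t-1}(x_{t-1}))$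 with independent internal randomness in each round. The mixed ERM oracle answers a query $(x_i,y_i)_{i\le m}\in(\mathcal X\times[0,1])^m$, $C\ge 0$, $\epsilon\in\{\pm1\}^n$, $x'\in\mathcal X^n$ with $\inf_{h\in\mathcal H}\big\{\sum_{i\le m}|h(x_i)-y_i|+C\sum_{j\le n}\epsilon_j h(x'_j)\big\}$; assume that, for fixed $y$, $C$ and $\epsilon$, this value is a measurable function of the features $(x,x')$. There is a single randomized program (on a machine with unit-cost real arithmetic, uniform sampling from $\{0,\dots,n\}$, and unit-cost calls to the mixed ERM oracle; it accesses $\mathcal H$ and the features only through the oracle) whose running time in round $t$ is, for all inputs and all random choices, at most a fixed polynomial in $t$; which, for every $T\ge2$, makes at most $O(\sqrt T\log T)$ oracle calls in each of the rounds $1,\dots,T$; and which computes for every class $\mathcal H$ as above a prediction rule $\Phi$ (not depending on $T$) such that the expectations in $\tilde r^{\mathsf{ob}}_T(\mathcal H,\Phi)$ exist and: 1. if $\tfrac12\le q\le1$ and $\mathsf{Rad}_T(\mathcal H)\le K T^q$ for all $T\ge1$, then $\tilde r^{\mathsf{ob}}_T(\mathcal H,\Phi)\le c\,T^q$ for all $T\ge1$,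 where $c$ depends only on $q$ and $K$; 2. if $\mathcal H$ is $\{0,1\}$-valued with finite VC dimension $\mathsf{VC}(\mathcal H)$, then $\tilde r^{\mathsf{ob}}_T(\mathcal H,\Phi)\le c\sqrt{\mathsf{VC}(\mathcal H)\,T}$ for all $T\ge1$, where $c$ is an absolute constant; 3. if $p>0$ and the $\alpha$-fat-shattering dimension of $\mathcal H$ is at most $K\alpha^{-p}$ for all $\alpha>0$, then $\tilde r^{\mathsf{ob}}_T(\mathcal H,\Phi)\le c\,T^{\max\{1/2,(p-1)/p\}}(\log T)^k$ for all $T\ge2$, where $k$ depends only on $p$ and $c$ only on $p$ and $K$. -/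

import Mathlib

open MeasureTheory
open scoped NNReal ENNReal unitInterval

universe u

noncomputable section

namespace HybridOnline

/-- The real value `+1` or `-1` of a sign bit. -/
def sgn (b : Bool) : ℝ := if b then 1 else -1

/-! ### Expert classes, the ERM task, complexity measures

An expert class is a set `H` of functions from the feature space `X` to `[0,1]`. -/

/-- The value of the mixed empirical risk minimization task for the absolute loss:
`inf_{h ∈ H} { ∑ᵢ |h(xᵢ) - yᵢ| + C ∑ⱼ εⱼ h(x'ⱼ) }`. -/
def mixedERM {X : Type u} (H : Set (X → I)) {m n : ℕ} (x : Fin m → X) (y : Fin m → I)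
    (C : ℝ≥0) (ε : Fin n → Bool) (x' : Fin n → X) : ℝ :=
  ⨅ h : H, (∑ i, |(h.1 (x i) : ℝ) - y i| + C * ∑ j, sgn (ε j) * h.1 (x' j))

/-- The value of the mixed ERM task depends measurably on the features in the query.  This is the
regularity under which the expectations in the regret and in the Rademacher complexity of the
class make sense; it holds e.g. for countable classes of measurable functions. -/
def MeasurableERM {X : Type u} [MeasurableSpace X] (H : Set (X → I)) : Prop :=
  ∀ (m n : ℕ) (y : Fin m → I) (C : ℝ≥0) (ε : Fin n → Bool),
    Measurable fun p : (Fin m → X) × (Fin n → X) => mixedERM H p.1 y C ε p.2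

/-- `Rad_T(H) = sup_{x ∈ X^T} E_ε [ sup_{h ∈ H} ∑ₜ εₜ h(xₜ) ]`, with `ε` uniform on `{-1,1}^T`. -/
def rademacher {X : Type u} (H : Set (X → I)) (T : ℕ) : ℝ :=
  ⨆ x : Fin T → X, (∑ ε : Fin T → Bool, ⨆ h : H, ∑ t, sgn (ε t) * h.1 (x t)) / 2 ^ T

def IsBinary {X : Type u} (H : Set (X → I)) : Prop :=
  ∀ h ∈ H, ∀ x, h x = 0 ∨ h x = 1

/-- The finite set `S` is shattered by the binary-valued class `H`. -/
def Shatters {X : Type u} (H : Set (X → I)) (S : Finset X) : Prop :=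
  ∀ E ⊆ S, ∃ h ∈ H, ∀ x ∈ S, h x = 1 ↔ x ∈ E

def vcDim {X : Type u} (H : Set (X → I)) : ℕ∞ :=
  ⨆ (S : Finset X) (_ : Shatters H S), (S.card : ℕ∞)

/-- The finite set `S` is `α`-shattered by `H`, with some witness `s`. -/
def FatShatters {X : Type u} (H : Set (X → I)) (α : ℝ) (S : Finset X) : Prop :=
  ∃ s : X → ℝ, ∀ E ⊆ S, ∃ h ∈ H, ∀ x ∈ S,
    (x ∈ E → s x + α ≤ h x) ∧ (x ∉ E → (h x : ℝ) ≤ s x - α)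

def fatDim {X : Type u} (H : Set (X → I)) (α : ℝ) : ℕ∞ :=
  ⨆ (S : Finset X) (_ : FatShatters H α S), (S.card : ℕ∞)

/-! ### Prediction rules and the oblivious regret -/

/-- A prediction rule: in the round that follows `t` completed rounds it is given the features
`x₀, …, xₜ` and the labels `y₀, …, yₜ₋₁`, and returns a distribution on `[0,1]`. -/
abbrev PredictionRule (X : Type u) : Type u :=
  (t : ℕ) → (Fin (t + 1) → X) → (Fin t → I) → ProbabilityMeasure I

/-- The law of the prediction in round `t`, for the features `x` and the labels `fₛ(xₛ)`. -/
def predictionLaw {X : Type u} (Φ : PredictionRule X) {T : ℕ} (f : Fin T → X → I)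
    (x : Fin T → X) (t : Fin T) : Measure I :=
  (Φ t (fun s => x (Fin.castLE t.isLt s))
    (fun s => f (Fin.castLE t.isLt.le s) (x (Fin.castLE t.isLt.le s))) : Measure I)

/-- The regret for the features `x`, averaged over the predictions (drawn with independent
internal randomness in the successive rounds). -/
def conditionalRegret {X : Type u} (H : Set (X → I)) (Φ : PredictionRule X) {T : ℕ}
    (f : Fin T → X → I) (x : Fin T → X) : ℝ :=
  ∫ yhat : Fin T → I,
    (∑ t, |(yhat t : ℝ) - f t (x t)| - ⨅ h : H, ∑ t, |(h.1 (x t) : ℝ) - f t (x t)|)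
    ∂(Measure.pi (predictionLaw Φ f x))

/-- The expected regret for i.i.d. features with law `μ` and the labels `yₜ = fₜ(xₜ)`. -/
def expectedRegret {X : Type u} [MeasurableSpace X] (H : Set (X → I)) (Φ : PredictionRule X)
    {T : ℕ} (f : Fin T → X → I) (μ : ProbabilityMeasure X) : ℝ :=
  ∫ x, conditionalRegret H Φ f x ∂(Measure.pi fun _ : Fin T => (μ : Measure X))

/-- The oblivious minimax regret of `Φ` relative to `H` at horizon `T`. -/
def obliviousRegret {X : Type u} [MeasurableSpace X] (H : Set (X → I)) (Φ : PredictionRule X)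
    (T : ℕ) : EReal :=
  ⨆ (f : Fin T → X → I) (_ : ∀ t, Measurable (f t)) (μ : ProbabilityMeasure X),
    (expectedRegret H Φ f μ : EReal)

/-- The expectations that enter the oblivious minimax regret exist. -/
def RegretExists {X : Type u} [MeasurableSpace X] (H : Set (X → I)) (Φ : PredictionRule X) :
    Prop :=
  ∀ (T : ℕ) (f : Fin T → X → I), (∀ t, Measurable (f t)) → ∀ μ : ProbabilityMeasure X,
    Integrable (conditionalRegret H Φ f) (Measure.pi fun _ : Fin T => (μ : Measure X))

/-! ### Randomized real-number programs with an ERM oracle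

Programs work on finitely many arrays of natural numbers and finitely many arrays of real numbers.
Features are opaque: a program refers to the feature `xₖ` by its index `k`, and can use it only
inside oracle queries; `H` is accessible only through the oracle. -/

/-- Expressions for natural numbers; `get a e` is the cell with index `e` of array `a`. -/
inductive NExpr : Type
  | lit (k : ℕ)
  | get (a : ℕ) (e : NExpr)
  | add (e₁ e₂ : NExpr)
  | sub (e₁ e₂ : NExpr)

/-- Expressions for real numbers. -/
inductive RExpr : Type
  | ofNat (e : NExpr)
  | get (a : ℕ) (e : NExpr)
  | add (e₁ e₂ : RExpr)
  | sub (e₁ e₂ : RExpr)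
  | mul (e₁ e₂ : RExpr)
  | div (e₁ e₂ : RExpr)

/-- Tests. -/
inductive Test : Type
  | leN (e₁ e₂ : NExpr)
  | leR (e₁ e₂ : RExpr)

/-- Programs.
* `setN a i e`, `setR a i e` assign the value of `e` to the cell `i` of the array `a`;
* `rand a i e` assigns to the cell `i` of the natural-number array `a` a uniformly random
  element of `{0, …, e}`;
* `ite c p q` runs `p` if the test `c` succeeds, and `q` otherwise;
* `loop v e p` runs `p` successively with `0, 1, …, e - 1` in cell `0` of the natural-number
  array `v`;
* `erm r i ax ay m C ae ax' n` submits to the oracle the query with the `m` labelled features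
  listed in the natural-number array `ax` (feature indices) and the real array `ay` (labels), the
  weight `C`, and the `n` signed features listed in the arrays `ae` (signs, where `0` means `-1`
  and anything else `+1`) and `ax'` (feature indices), and assigns the answer to the
  cell `i` of the real array `r`. -/
inductive Program : Type
  | skip
  | setN (a : ℕ) (i : NExpr) (e : NExpr)
  | setR (a : ℕ) (i : NExpr) (e : RExpr)
  | rand (a : ℕ) (i : NExpr) (e : NExpr)
  | seq (p q : Program)
  | ite (c : Test) (p q : Program)
  | loop (v : ℕ) (e : NExpr) (p : Program)
  | erm (r : ℕ) (i : NExpr) (ax ay : ℕ) (m : NExpr) (C : RExpr) (ae ax' : ℕ) (n : NExpr)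

/-- The memory, the running time so far and the number of oracle calls so far. -/
structure State : Type where
  nat : ℕ → ℕ → ℕ
  real : ℕ → ℕ → ℝ
  time : ℕ
  calls : ℕ

def NExpr.eval (s : State) : NExpr → ℕ
  | lit k => k
  | get a e => s.nat a (e.eval s)
  | add e₁ e₂ => e₁.eval s + e₂.eval s
  | sub e₁ e₂ => e₁.eval s - e₂.eval s

def NExpr.cost : NExpr → ℕ
  | lit _ => 1
  | get _ e => e.cost + 1
  | add e₁ e₂ => e₁.cost + e₂.cost + 1
  | sub e₁ e₂ => e₁.cost + e₂.cost + 1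

def RExpr.eval (s : State) : RExpr → ℝ
  | ofNat e => (e.eval s : ℝ)
  | get a e => s.real a (e.eval s)
  | add e₁ e₂ => e₁.eval s + e₂.eval s
  | sub e₁ e₂ => e₁.eval s - e₂.eval s
  | mul e₁ e₂ => e₁.eval s * e₂.eval s
  | div e₁ e₂ => e₁.eval s / e₂.eval s

def RExpr.cost : RExpr → ℕ
  | ofNat e => e.cost + 1
  | get _ e => e.cost + 1
  | add e₁ e₂ => e₁.cost + e₂.cost + 1
  | sub e₁ e₂ => e₁.cost + e₂.cost + 1
  | mul e₁ e₂ => e₁.cost + e₂.cost + 1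
  | div e₁ e₂ => e₁.cost + e₂.cost + 1

def Test.holds (s : State) : Test → Prop
  | leN e₁ e₂ => e₁.eval s ≤ e₂.eval s
  | leR e₁ e₂ => e₁.eval s ≤ e₂.eval s

def Test.cost : Test → ℕ
  | leN e₁ e₂ => e₁.cost + e₂.cost + 1
  | leR e₁ e₂ => e₁.cost + e₂.cost + 1

def State.tick (s : State) (c : ℕ) : State := { s with time := s.time + c }

def State.writeN (s : State) (a i v : ℕ) : State :=
  { s with nat := Function.update s.nat a (Function.update (s.nat a) i v) }

def State.writeR (s : State) (a i : ℕ) (v : ℝ) : State :=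
  { s with real := Function.update s.real a (Function.update (s.real a) i v) }

/-- `iter f n` performs `f 0`, `f 1`, …, `f (n - 1)` in this order. -/
def iter (f : ℕ → State → PMF State) : ℕ → State → PMF State
  | 0, s => PMF.pure s
  | n + 1, s => (iter f n s).bind (f n)

/-- The answer to the query stored in the state `s`, where `feat k` is the feature with index `k`.
Labels are clamped to `[0,1]` and the weight to `[0,∞)`, so that every query is admissible. -/
def oracleAnswer {X : Type u} (H : Set (X → I)) (feat : ℕ → X) (s : State)
    (ax ay m : ℕ) (C : ℝ) (ae ax' n : ℕ) : ℝ :=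
  mixedERM H (fun i : Fin m => feat (s.nat ax i))
    (fun i : Fin m => Set.projIcc (0 : ℝ) 1 zero_le_one (s.real ay i))
    C.toNNReal (fun j : Fin n => decide (s.nat ae j ≠ 0)) (fun j : Fin n => feat (s.nat ax' j))

open scoped Classical in
/-- The distribution of the state after running a program.  Every operation, random draw and
oracle call takes unit time. -/
def Program.exec {X : Type u} (H : Set (X → I)) (feat : ℕ → X) : Program → State → PMF State
  | skip, s => PMF.pure (s.tick 1)
  | setN a i e, s =>
      PMF.pure ((s.writeN a (i.eval s) (e.eval s)).tick (i.cost + e.cost + 1))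
  | setR a i e, s =>
      PMF.pure ((s.writeR a (i.eval s) (e.eval s)).tick (i.cost + e.cost + 1))
  | rand a i e, s =>
      (PMF.uniformOfFintype (Fin (e.eval s + 1))).map fun k =>
        (s.writeN a (i.eval s) k).tick (i.cost + e.cost + 1)
  | seq p q, s => (p.exec H feat s).bind (q.exec H feat)
  | ite c p q, s =>
      if c.holds s then p.exec H feat (s.tick (c.cost + 1))
      else q.exec H feat (s.tick (c.cost + 1))
  | loop v e p, s =>
      iter (fun k s' => p.exec H feat ((s'.writeN v 0 k).tick 1)) (e.eval s)
        (s.tick (e.cost + 1))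
  | erm r i ax ay m C ae ax' n, s =>
      PMF.pure
        { (s.writeR r (i.eval s)
            (oracleAnswer H feat s ax ay (m.eval s) (C.eval s) ae ax' (n.eval s))).tick
              (i.cost + m.cost + C.cost + n.cost + 1) with
          calls := s.calls + 1 }

/-- The initial state in the round that follows `t` completed rounds: the cell `0` of the
natural-number array `0` holds `t`, the real array `0` holds the labels seen so far, and everything
else is `0`. -/
def initialState {t : ℕ} (y : Fin t → I) : State where
  nat a i := if a = 0 ∧ i = 0 then t else 0
  real a i := if h : a = 0 ∧ i < t then (y ⟨i, h.2⟩ : ℝ) else 0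
  time := 0
  calls := 0

/-- The distribution of the final state in the round that follows `t` completed rounds.  The
available features are `x₀, …, xₜ`; an index beyond `t` denotes `xₜ`. -/
def Program.run {X : Type u} (P : Program) (H : Set (X → I)) {t : ℕ} (x : Fin (t + 1) → X)
    (y : Fin t → I) : PMF State :=
  P.exec H (fun k => x ⟨min k t, Nat.lt_succ_of_le (min_le_right k t)⟩) (initialState y)

/-- The prediction found in a final state: the cell `0` of the real array `1`, clamped
to `[0,1]`. -/
def State.output (s : State) : I := Set.projIcc (0 : ℝ) 1 zero_le_one (s.real 1 0)

/-- The prediction rule computed by a program that has oracle access to `H`. -/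
def Program.rule {X : Type u} (P : Program) (H : Set (X → I)) : PredictionRule X :=
  fun _ x y => ⟨((P.run H x y).map State.output).toMeasure, inferInstance⟩

/-- On all inputs and for all random choices, the running time is polynomial in the round. -/
def Program.OracleEfficient (P : Program) : Prop :=
  ∃ p : Polynomial ℕ, ∀ (X : Type u) (H : Set (X → I)), H.Nonempty →
    ∀ (t : ℕ) (x : Fin (t + 1) → X) (y : Fin t → I), ∀ s ∈ (P.run H x y).support,
      s.time ≤ p.eval (t + 1)

/-- With horizon `T`, every round uses at most `O(√T log T)` oracle calls, on all inputs and for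
all random choices. -/
def Program.FewOracleCalls (P : Program) : Prop :=
  ∃ c : ℝ, ∀ (X : Type u) (H : Set (X → I)), H.Nonempty →
    ∀ T : ℕ, 2 ≤ T → ∀ t < T, ∀ (x : Fin (t + 1) → X) (y : Fin t → I),
      ∀ s ∈ (P.run H x y).support, (s.calls : ℝ) ≤ c * (√(T : ℝ) * Real.log T)

end HybridOnline

end

open HybridOnline

/-! The algorithm is follow-the-perturbed-leader by random playout, restarted on epochs `{a, …, 2a}`
with `a = 2 ^ k - 1`. In round `a + m` it calls the oracle with the labelled examples of the epoch,
the current feature labelled once `0` and once `1`, and random signs on `n = a - m` ghost features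
standing for the rest of the epoch. The prediction `(1 + e₀ - e₁) / 2` balances the two labels. For
every choice of signs, the loss plus minus the ERM value with the true label is at most the average
of minus the ERM value over a random sign on the current feature (`abs_equalize_sub_le`,
`signAvg_round`).

No knowledge of `μ` is needed, because the ghosts are the past features `m, …, a - 1`. Between
rounds `a + m` and `a + m + 1` the ghost `x_m` is retired and `x_{a+m+1}` takes its place. As the
features are i.i.d. and the labels are `f_t(x_t)`, exchanging these two coordinates preserves the
law and leaves every label in use unchanged (`integral_postValue_eq`). So the round inequalities
telescope: the regret on the epoch, or on an initial part of it, is at most `Rad_{a+1} = Rad_{2^k}`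
(`integral_epoch_le`). The best expert in hindsight loses at least as much as the epochwise best
experts together, whence the regret at `T` is at most the sum of `Rad_{2^i}` for `i ≤ log₂ T`
(`totalRegret_le`). For a polynomial bound on `Rad` this is a geometric sum.

The other two bounds estimate `Rad` by chaining over `ℓ²` coverings obtained from maximal packings
(`signAvg_iSup_le_chaining`). For VC classes a few random coordinates already separate a packing,
and Sauer–Shelah on those coordinates bounds its size independently of `T`
(`log_card_le_of_pairwise_far`). For fat-shattering classes the experts are rounded to integer
levels, and a separated family of integer functions is shown to shatter so many sets of point-level
pairs that one of them must be large (`two_pow_le_card_levelShatterer`). -/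

noncomputable section

namespace HybridOnline

/-! ### The program -/

namespace Playout

/-- The number of completed rounds. -/
def tE : NExpr := .get 0 (.lit 0)
/-- The first round of the current epoch. -/
def aE : NExpr := .get 1 (.lit 0)
/-- The loop counter. -/
def kE : NExpr := .get 2 (.lit 0)
/-- The number of completed rounds of the current epoch. -/
def mE : NExpr := .sub tE aE
/-- The number of remaining rounds of the current epoch. -/
def nE : NExpr := .sub aE mE

/-- Cell `0` of array `1` climbs through `0, 1, 3, 7, …` as long as the next value is at most `t`;
`t` passes suffice since `log₂ (t + 1) ≤ t`. -/
def epochLoop : Program :=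
  .loop 2 tE (.ite (.leN (.add (.add aE aE) (.lit 1)) tE)
    (.setN 1 (.lit 0) (.add (.add aE aE) (.lit 1))) .skip)

/-- The loop copies one label more than the `m` known ones: position `m` reads index `t` of the
label array, which is initially `0`. Thus the current feature already carries the label `0` required
by the first query. -/
def labelLoop : Program :=
  .loop 2 (.add mE (.lit 1)) (.seq (.setN 3 kE (.add aE kE)) (.setR 2 kE (.get 0 (.add aE kE))))

/-- Array `4` lists the ghost features and array `5` their random signs. -/
def ghostLoop : Program :=
  .loop 2 nE (.seq (.setN 4 kE (.add mE kE)) (.rand 5 kE (.lit 1)))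

def query (i : ℕ) : Program :=
  .erm 3 (.lit i) 3 2 (.add mE (.lit 1)) (.ofNat (.lit 1)) 5 4 nE

/-- The two queries share the same random signs and differ only in the label of the current feature.
Clamping to `[0,1]` is left to `State.output`. -/
def final : Program :=
  .seq (query 0) (.seq (.setR 2 mE (.ofNat (.lit 1))) (.seq (query 1)
    (.setR 1 (.lit 0) (.div (.sub (.add (.ofNat (.lit 1)) (.get 3 (.lit 0))) (.get 3 (.lit 1)))
      (.ofNat (.lit 2))))))

/-- Follow the perturbed leader by random playout.  The rounds are divided into the epochs
`{a, …, 2 * a}` with `a = 2ᵏ - 1`.  In the round `a + m` the features of the rounds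
`a + m + 1, …, 2 * a`, which are still to come, are replaced by the past features `m, …, a - 1`. -/
def program : Program := .seq epochLoop (.seq labelLoop (.seq ghostLoop final))

end Playout

/-- The first round of the epoch that contains the round `t`. -/
def epochStart (t : ℕ) : ℕ := 2 ^ Nat.log 2 (t + 1) - 1

/-! ### Running the program -/

section Exec

lemma uniformOfFintype_eq_bind {α β γ : Type*} [Fintype α] [Fintype β] [Fintype γ]
    [Nonempty α] [Nonempty β] [Nonempty γ] (e : α × β ≃ γ) :
    PMF.uniformOfFintype γ = (PMF.uniformOfFintype α).bind fun a =>
      (PMF.uniformOfFintype β).map fun b => e (a, b) := by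
  classical
  ext c
  obtain ⟨⟨a, b⟩, rfl⟩ := e.surjective c
  have hc : Fintype.card γ = Fintype.card α * Fintype.card β := by
    rw [← Fintype.card_congr e, Fintype.card_prod]
  rw [PMF.bind_apply, tsum_fintype, Finset.sum_eq_single a]
  · rw [PMF.map_apply, tsum_fintype, Finset.sum_eq_single b]
    · simp only [PMF.uniformOfFintype_apply, hc, Nat.cast_mul, if_true]
      rw [ENNReal.mul_inv (by simp) (by simp)]
    · intro b' _ hb
      rw [if_neg]
      simpa using fun h => hb h.symm
    · simp
  · intro a' _ ha
    have : ((PMF.uniformOfFintype β).map fun b => e (a', b)) (e (a, b)) = 0 := by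
      rw [PMF.map_apply, tsum_fintype]
      refine Finset.sum_eq_zero fun b' _ => if_neg ?_
      simpa using fun h _ => ha h.symm
    rw [this, mul_zero]
  · simp

lemma uniformOfFintype_map_equiv {α β : Type*} [Fintype α] [Fintype β] [Nonempty α] [Nonempty β]
    (e : α ≃ β) : (PMF.uniformOfFintype α).map e = PMF.uniformOfFintype β := by
  classical
  ext c
  obtain ⟨a, rfl⟩ := e.surjective c
  rw [PMF.map_apply, tsum_fintype, Finset.sum_eq_single a]
  · simp [Fintype.card_congr e]
  · intro a' _ ha
    rw [if_neg]
    simpa using fun h => ha h.symm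
  · simp

/-- A deterministic loop preserves its invariant. -/
lemma iter_eq_pure {body : ℕ → State → PMF State} {n : ℕ} {s : State} (Inv : ℕ → State → Prop)
    (h0 : Inv 0 s)
    (hstep : ∀ k < n, ∀ s, Inv k s → ∃ s', body k s = PMF.pure s' ∧ Inv (k + 1) s') :
    ∃ s', iter body n s = PMF.pure s' ∧ Inv n s' := by
  induction n with
  | zero => exact ⟨s, rfl, h0⟩
  | succ n ih =>
    obtain ⟨s', hs', hi⟩ := ih fun k hk => hstep k (by omega)
    obtain ⟨s'', hs'', hinv⟩ := hstep n (by omega) s' hi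
    exact ⟨s'', by rw [iter, hs', PMF.pure_bind, hs''], hinv⟩

/-- A loop that draws one random bit in each pass. -/
lemma iter_eq_map {body : ℕ → State → PMF State} {n : ℕ} {s : State}
    (Inv : (k : ℕ) → (Fin k → Bool) → State → Prop) (h0 : ∀ ε, Inv 0 ε s)
    (hstep : ∀ k < n, ∀ ε s, Inv k ε s → ∃ g : Bool → State,
      body k s = (PMF.uniformOfFintype Bool).map g ∧ ∀ b, Inv (k + 1) (Fin.snoc ε b) (g b)) :
    ∃ g : (Fin n → Bool) → State,
      iter body n s = (PMF.uniformOfFintype (Fin n → Bool)).map g ∧ ∀ ε, Inv n ε (g ε) := by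
  induction n with
  | zero =>
    refine ⟨fun _ => s, ?_, h0⟩
    rw [iter]
    exact (PMF.map_const _ _).symm
  | succ n ih =>
    obtain ⟨g, hg, hi⟩ := ih fun k hk => hstep k (by omega)
    choose G hG hG' using fun ε => hstep n (by omega) ε (g ε) (hi ε)
    refine ⟨fun ε => G (Fin.init ε) (ε (Fin.last n)), ?_, fun ε => ?_⟩
    -- Uniform bits of length `n + 1` are uniform bits of length `n` followed by an independent last
    -- bit; `prodComm` is there because `Fin.snocEquiv` takes the last entry first.
    · rw [iter, hg, PMF.bind_map, uniformOfFintype_eq_bind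
        ((Equiv.prodComm _ _).trans (Fin.snocEquiv fun _ : Fin (n + 1) => Bool)), PMF.map_bind]
      congr 1
      funext ε
      simp only [Function.comp_apply, hG, PMF.map_comp]
      congr 1
      funext b
      simp [Fin.snocEquiv]
    · simpa using hG' (Fin.init ε) (ε (Fin.last n))

variable {X : Type u} (H : Set (X → I)) (feat : ℕ → X)

open Playout

/-- The test in `epochLoop` succeeds exactly while the exponent is below its final value, so after
`k` passes the exponent is `min k (log₂ (t + 1))`. -/
lemma two_pow_sub_one_le {p t : ℕ} :
    (2 ^ p - 1) + (2 ^ p - 1) + 1 ≤ t ↔ p + 1 ≤ Nat.log 2 (t + 1) := by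
  rw [Nat.le_log_iff_pow_le (by norm_num) (by omega), pow_succ]
  have := Nat.one_le_two_pow (n := p)
  omega

lemma exec_epochLoop (s : State) (h1 : s.nat 1 0 = 0) :
    ∃ s', epochLoop.exec H feat s = PMF.pure s' ∧ s'.nat 0 0 = s.nat 0 0 ∧
      s'.nat 1 0 = epochStart (s.nat 0 0) ∧ s'.real = s.real ∧ s'.calls = s.calls ∧
      s'.time ≤ s.time + 30 * (s.nat 0 0 + 1) := by
  have key := iter_eq_pure (n := s.nat 0 0) (s := s.tick (tE.cost + 1))
    (body := fun k s' => (Program.ite (.leN (.add (.add aE aE) (.lit 1)) tE)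
      (.setN 1 (.lit 0) (.add (.add aE aE) (.lit 1))) .skip).exec H feat ((s'.writeN 2 0 k).tick 1))
    (fun k s' => s'.nat 0 0 = s.nat 0 0 ∧
      s'.nat 1 0 = 2 ^ (min k (Nat.log 2 (s.nat 0 0 + 1))) - 1 ∧ s'.real = s.real ∧
      s'.calls = s.calls ∧ s'.time ≤ s.time + 30 * (k + 1))
    (by simp [State.tick, h1, tE, NExpr.cost]) ?_
  · obtain ⟨s', hs', h⟩ := key
    refine ⟨s', ?_, h.1, ?_, h.2.2⟩
    · rw [← hs']
      rfl
    · rw [h.2.1, epochStart, min_eq_right]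
      have := Nat.log_lt_self 2 (x := s.nat 0 0 + 1) (by omega)
      omega
  · rintro k - s' ⟨i0, i1, i2, i3, i4⟩
    by_cases hc : 2 ^ (min k (Nat.log 2 (s.nat 0 0 + 1))) - 1 +
        (2 ^ (min k (Nat.log 2 (s.nat 0 0 + 1))) - 1) + 1 ≤ s.nat 0 0
    · refine ⟨_, by
        rw [Program.exec, if_pos (by simpa [Test.holds, NExpr.eval, aE, tE, State.tick,
          State.writeN, i0, i1] using hc)]
        rfl, ?_⟩
      have hp := two_pow_sub_one_le.1 hc
      have h2 : min (k + 1) (Nat.log 2 (s.nat 0 0 + 1)) =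
        min k (Nat.log 2 (s.nat 0 0 + 1)) + 1 := by omega
      refine ⟨?_, ?_, ?_, ?_, ?_⟩ <;>
        simp [State.tick, State.writeN, NExpr.eval, aE, tE, NExpr.cost, Test.cost, i0, i1, i2, i3]
      · rw [h2, pow_succ]
        have := Nat.one_le_two_pow (n := min k (Nat.log 2 (s.nat 0 0 + 1)))
        omega
      · omega
    · refine ⟨_, by
        rw [Program.exec, if_neg (by simpa [Test.holds, NExpr.eval, aE, tE, State.tick,
          State.writeN, i0, i1] using hc)]
        rfl, ?_⟩
      have hp := mt two_pow_sub_one_le.2 hc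
      have h2 : min (k + 1) (Nat.log 2 (s.nat 0 0 + 1)) =
        min k (Nat.log 2 (s.nat 0 0 + 1)) := by omega
      refine ⟨?_, ?_, ?_, ?_, ?_⟩ <;>
        simp [State.tick, State.writeN, aE, tE, NExpr.cost, Test.cost, i0, i1, i2, i3, h2]
      omega

lemma exec_labelLoop (s : State) {a m : ℕ} (h0 : s.nat 0 0 = a + m) (h1 : s.nat 1 0 = a) :
    ∃ s', labelLoop.exec H feat s = PMF.pure s' ∧ s'.nat 0 0 = a + m ∧ s'.nat 1 0 = a ∧
      (∀ i < m + 1, s'.nat 3 i = a + i) ∧ (∀ i < m + 1, s'.real 2 i = s.real 0 (a + i)) ∧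
      s'.calls = s.calls ∧ s'.time ≤ s.time + 30 * (m + 2) := by
  have key := iter_eq_pure (n := m + 1) (s := s.tick ((NExpr.add mE (.lit 1)).cost + 1))
    (body := fun k s' => (Program.seq (.setN 3 kE (.add aE kE))
      (.setR 2 kE (.get 0 (.add aE kE)))).exec H feat ((s'.writeN 2 0 k).tick 1))
    (fun k s' => s'.nat 0 0 = a + m ∧ s'.nat 1 0 = a ∧ s'.real 0 = s.real 0 ∧
      (∀ i < k, s'.nat 3 i = a + i) ∧ (∀ i < k, s'.real 2 i = s.real 0 (a + i)) ∧
      s'.calls = s.calls ∧ s'.time ≤ s.time + 30 * (k + 1))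
    (by simp [State.tick, h0, h1, tE, aE, mE, NExpr.cost]) ?_
  · obtain ⟨s', hs', i0, i1, -, i3⟩ := key
    refine ⟨s', ?_, i0, i1, i3⟩
    rw [← hs', labelLoop, Program.exec]
    simp [NExpr.eval, mE, tE, aE, h0, h1]
  · rintro k - s' ⟨i0, i1, i2, i3, i4, i5, i6⟩
    refine ⟨_, by rw [Program.exec, Program.exec, PMF.pure_bind, Program.exec], ?_⟩
    refine ⟨?_, ?_, ?_, ?_, ?_, ?_, ?_⟩
    · simp [State.tick, State.writeN, State.writeR, i0]
    · simp [State.tick, State.writeN, State.writeR, i1]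
    · simp [State.tick, State.writeN, State.writeR, i2]
    · intro i hi
      by_cases hik : i = k
      · simp [State.tick, State.writeN, State.writeR, NExpr.eval, aE, kE, i1, hik]
      · simp [State.tick, State.writeN, State.writeR, NExpr.eval, kE, hik, i3 i (by omega)]
    · intro i hi
      by_cases hik : i = k
      · simp [State.tick, State.writeN, State.writeR, NExpr.eval, RExpr.eval, aE, kE, i1, i2, hik]
      · simp [State.tick, State.writeN, State.writeR, NExpr.eval, kE, hik, i4 i (by omega)]
    · simp [State.tick, State.writeN, State.writeR, i5]
    · simp [State.tick, State.writeN, State.writeR, NExpr.cost, RExpr.cost, aE, kE]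
      omega

lemma exec_ghostLoop (s : State) {a m n : ℕ} (hn : m + n = a) (h0 : s.nat 0 0 = a + m)
    (h1 : s.nat 1 0 = a) :
    ∃ g : (Fin n → Bool) → State,
      ghostLoop.exec H feat s = (PMF.uniformOfFintype (Fin n → Bool)).map g ∧
      ∀ ε, (g ε).nat 0 0 = a + m ∧ (g ε).nat 1 0 = a ∧ (g ε).nat 3 = s.nat 3 ∧
        (g ε).real = s.real ∧ (∀ i < n, (g ε).nat 4 i = m + i) ∧
        (∀ i : Fin n, ((g ε).nat 5 i ≠ 0) ↔ ε i = true) ∧ (g ε).calls = s.calls ∧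
        (g ε).time ≤ s.time + 30 * (n + 1) := by
  have key := iter_eq_map (n := n) (s := s.tick (nE.cost + 1))
    (body := fun k s' => (Program.seq (.setN 4 kE (.add mE kE)) (.rand 5 kE (.lit 1))).exec H feat
      ((s'.writeN 2 0 k).tick 1))
    (fun k ε s' => s'.nat 0 0 = a + m ∧ s'.nat 1 0 = a ∧ s'.nat 3 = s.nat 3 ∧
        s'.real = s.real ∧ (∀ i < k, s'.nat 4 i = m + i) ∧
        (∀ i : Fin k, (s'.nat 5 i ≠ 0) ↔ ε i = true) ∧ s'.calls = s.calls ∧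
        s'.time ≤ s.time + 30 * (k + 1))
    (by simp [State.tick, h0, h1, tE, aE, mE, nE, NExpr.cost]) ?_
  · obtain ⟨g, hg, hi⟩ := key
    refine ⟨g, ?_, hi⟩
    rw [← hg, ghostLoop, Program.exec]
    have : nE.eval s = n := by
      simp [NExpr.eval, nE, mE, tE, aE, h0, h1]
      omega
    rw [this]
  · rintro k - ε s' ⟨i0, i1, i2, i3, i4, i5, i6, i7⟩
    refine ⟨_, by
      rw [Program.exec, Program.exec, PMF.pure_bind, Program.exec]
      change PMF.map _ (PMF.map (fun i : Fin 2 => (i : ℕ)) (PMF.uniformOfFintype (Fin 2))) = _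
      rw [PMF.map_comp, ← uniformOfFintype_map_equiv finTwoEquiv.symm, PMF.map_comp], fun b => ?_⟩
    refine ⟨?_, ?_, ?_, ?_, ?_, ?_, ?_, ?_⟩
    · simp [State.tick, State.writeN, i0]
    · simp [State.tick, State.writeN, i1]
    · simp [State.tick, State.writeN, i2]
    · simp [State.tick, State.writeN, i3]
    · intro i hi
      by_cases hik : i = k
      · simp [State.tick, State.writeN, NExpr.eval, aE, kE, tE, mE, i0, i1, hik]
      · simp [State.tick, State.writeN, NExpr.eval, kE, hik, i4 i (by omega)]
    · intro i
      induction i using Fin.lastCases with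
      | last =>
        cases b <;> simp [State.tick, State.writeN, NExpr.eval, kE, finTwoEquiv]
      | cast i =>
        have hik : (i : ℕ) ≠ k := i.isLt.ne
        have := i5 i
        simpa [State.tick, State.writeN, NExpr.eval, kE, hik] using this
    · simp [State.tick, State.writeN, i6]
    · simp [State.tick, State.writeN, NExpr.cost, aE, kE, mE, tE]
      omega

/-- The prediction that equalizes the two labels `0` and `1`, where `e₀`, `e₁` are the values of
the ERM task with the label `0` and `1` of the current feature. -/
def equalize (e₀ e₁ : ℝ) : I := Set.projIcc (0 : ℝ) 1 zero_le_one ((1 + e₀ - e₁) / 2)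

/-- The value of the query made in the round `a + m`, when the current feature is given the
label `b`. -/
def queryValue (a m n : ℕ) (y : ℕ → I) (b : I) (ε : Fin n → Bool) : ℝ :=
  mixedERM H (fun i : Fin (m + 1) => feat (a + i)) (Fin.snoc (fun i : Fin m => y (a + i)) b) 1 ε
    (fun i : Fin n => feat (m + i))

lemma oracleAnswer_eq_queryValue {s : State} {a m n : ℕ} {y : ℕ → I} {b : I} {ε : Fin n → Bool}
    (h3 : ∀ i < m + 1, s.nat 3 i = a + i) (hy : ∀ i < m, s.real 2 i = y (a + i))
    (hb : s.real 2 m = b) (h4 : ∀ i < n, s.nat 4 i = m + i)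
    (h5 : ∀ i : Fin n, (s.nat 5 i ≠ 0) ↔ ε i = true) :
    oracleAnswer H feat s 3 2 (m + 1) 1 5 4 n = queryValue H feat a m n y b ε := by
  unfold oracleAnswer queryValue
  congr 1
  · funext i
    rw [h3 i i.isLt]
  · funext i
    induction i using Fin.lastCases with
    | last => simp [hb]
    | cast i => simp [hy i i.isLt]
  · exact Real.toNNReal_one
  · funext i
    rw [Bool.eq_iff_iff, decide_eq_true_iff]
    exact h5 i
  · funext i
    rw [h4 i i.isLt]

lemma exec_query (s : State) {a m n : ℕ} (hn : m + n = a) {y : ℕ → I} {b : I} {ε : Fin n → Bool}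
    (h0 : s.nat 0 0 = a + m) (h1 : s.nat 1 0 = a)
    (h3 : ∀ i < m + 1, s.nat 3 i = a + i) (hy : ∀ i < m, s.real 2 i = y (a + i))
    (hb : s.real 2 m = b) (h4 : ∀ i < n, s.nat 4 i = m + i)
    (h5 : ∀ i : Fin n, (s.nat 5 i ≠ 0) ↔ ε i = true) (i : ℕ) :
    ∃ s', (query i).exec H feat s = PMF.pure s' ∧ s'.nat = s.nat ∧
      (∀ k, k ≠ 3 → s'.real k = s.real k) ∧
      s'.real 3 = Function.update (s.real 3) i (queryValue H feat a m n y b ε) ∧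
      s'.calls = s.calls + 1 ∧ s'.time ≤ s.time + 40 := by
  refine ⟨_, rfl, rfl, fun k hk => ?_, ?_, rfl, ?_⟩
  · simp [State.tick, State.writeR, hk]
  · have hm : (NExpr.add mE (.lit 1)).eval s = m + 1 := by
      simp [NExpr.eval, mE, tE, aE, h0, h1]
    have hn' : nE.eval s = n := by
      simp [NExpr.eval, nE, mE, tE, aE, h0, h1]
      omega
    have hC : (RExpr.ofNat (.lit 1)).eval s = 1 := by simp [RExpr.eval, NExpr.eval]
    simp only [State.tick, State.writeR, Function.update_self, hm, hn', hC]
    rw [oracleAnswer_eq_queryValue H feat h3 hy hb h4 h5]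
    rfl
  · simp [State.tick, State.writeR, NExpr.cost, RExpr.cost, mE, nE, tE, aE]

lemma exec_final (s : State) {a m n : ℕ} (hn : m + n = a) {y : ℕ → I} {ε : Fin n → Bool}
    (h0 : s.nat 0 0 = a + m) (h1 : s.nat 1 0 = a)
    (h3 : ∀ i < m + 1, s.nat 3 i = a + i) (hy : ∀ i < m, s.real 2 i = y (a + i))
    (hb : s.real 2 m = 0) (h4 : ∀ i < n, s.nat 4 i = m + i)
    (h5 : ∀ i : Fin n, (s.nat 5 i ≠ 0) ↔ ε i = true) :
    ∃ s', final.exec H feat s = PMF.pure s' ∧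
      s'.output = equalize (queryValue H feat a m n y 0 ε) (queryValue H feat a m n y 1 ε) ∧
      s'.calls = s.calls + 2 ∧ s'.time ≤ s.time + 200 := by
  obtain ⟨s₁, e₁, p1, p2, p3, p4, p5⟩ :=
    exec_query H feat s hn (b := 0) h0 h1 h3 hy (by simpa using hb) h4 h5 0
  set s₂ := (s₁.writeR 2 m 1).tick (mE.cost + (RExpr.ofNat (.lit 1)).cost + 1) with hs₂
  have e₂ : (Program.setR 2 mE (.ofNat (.lit 1))).exec H feat s₁ = PMF.pure s₂ := by
    have hm : mE.eval s₁ = m := by simp [NExpr.eval, mE, tE, aE, p1, h0, h1]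
    rw [Program.exec, hm, hs₂]
    simp [RExpr.eval, NExpr.eval]
  have q1 : s₂.nat = s.nat := by rw [← p1]; rfl
  have q2 : s₂.real 3 = s₁.real 3 := by simp [hs₂, State.tick, State.writeR]
  have q3 : s₂.real 2 = Function.update (s.real 2) m 1 := by
    simp [hs₂, State.tick, State.writeR, p2]
  obtain ⟨s₃, e₃, r1, r2, r3, r4, r5⟩ :=
    exec_query H feat s₂ hn (b := 1) (by rw [q1, h0]) (by rw [q1, h1]) (by rwa [q1])
      (fun i hi => by rw [q3, Function.update_of_ne hi.ne, hy i hi]) (by simp [q3])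
      (by rwa [q1]) (by rwa [q1]) 1
  refine ⟨_, by
    rw [final, Program.exec, e₁, PMF.pure_bind, Program.exec, e₂, PMF.pure_bind, Program.exec, e₃,
      PMF.pure_bind, Program.exec], ?_, ?_, ?_⟩
  · simp [State.output, equalize, State.tick, State.writeR, RExpr.eval, NExpr.eval, r3, q2, p3]
  · have : s₂.calls = s₁.calls := rfl
    simp [State.tick, State.writeR, r4, this, p4]
  · have : s₂.time = s₁.time + 8 := rfl
    simp [State.tick, State.writeR, NExpr.cost, RExpr.cost]
    omega

end Exec

/-! ### The complete program: its prediction, running time and oracle calls. -/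

section Run

variable {X : Type u} (H : Set (X → I))

/-- The feature with index `k`, where an index beyond `t` denotes `xₜ`. -/
def clampFeature {t : ℕ} (x : Fin (t + 1) → X) (k : ℕ) : X :=
  x ⟨min k t, Nat.lt_succ_of_le (min_le_right k t)⟩

/-- The labels seen so far, extended by `0`. -/
def extendLabels {t : ℕ} (y : Fin t → I) (k : ℕ) : I := if h : k < t then y ⟨k, h⟩ else 0

open Playout

/-- Randomness enters only through the ghost signs, so the final state is a function of `n` uniform
bits. Output, number of calls and running time can then be read off for each sign pattern. -/
lemma program_run_eq_map {t a m n : ℕ} (ha : epochStart t = a) (hm : a + m = t) (hn : m + n = a)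
    (x : Fin (t + 1) → X) (y : Fin t → I) :
    ∃ g : (Fin n → Bool) → State,
      program.run H x y = (PMF.uniformOfFintype (Fin n → Bool)).map g ∧
      ∀ ε, (g ε).output =
          equalize (queryValue H (clampFeature x) a m n (extendLabels y) 0 ε)
            (queryValue H (clampFeature x) a m n (extendLabels y) 1 ε) ∧
        (g ε).calls = 2 ∧ (g ε).time ≤ 400 * (t + 1) := by
  obtain ⟨s₁, e₁, a0, a1, ar, ac, at'⟩ :=
    exec_epochLoop H (clampFeature x) (initialState y) (by simp [initialState])
  have ht : (initialState y).nat 0 0 = t := by simp [initialState]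
  rw [ht] at a0 a1 at'
  rw [ha] at a1
  obtain ⟨s₂, e₂, b0, b1, b3, b2, bc, bt⟩ :=
    exec_labelLoop H (clampFeature x) s₁ (a0.trans hm.symm) a1
  obtain ⟨g, e₃, hg⟩ := exec_ghostLoop H (clampFeature x) s₂ hn b0 b1
  have hreal : ∀ i, (initialState y).real 0 i = extendLabels y i := fun i => by
    by_cases hi : i < t <;> simp [initialState, extendLabels, hi]
  have key : ∀ ε, ∃ s', final.exec H (clampFeature x) (g ε) = PMF.pure s' ∧
      s'.output = equalize (queryValue H (clampFeature x) a m n (extendLabels y) 0 ε)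
        (queryValue H (clampFeature x) a m n (extendLabels y) 1 ε) ∧
      s'.calls = (g ε).calls + 2 ∧ s'.time ≤ (g ε).time + 200 := by
    intro ε
    obtain ⟨c0, c1, c3, cr, c4, c5, -, -⟩ := hg ε
    refine exec_final H (clampFeature x) (g ε) hn c0 c1 (fun i hi => c3 ▸ b3 i hi)
      (fun i hi => ?_) ?_ c4 c5
    · rw [cr, b2 i (by omega), ar, hreal]
    · rw [cr, b2 m (by omega), ar, hreal, extendLabels, dif_neg (by omega)]
      rfl
  choose G hG hout hcalls htime using key
  refine ⟨G, ?_, fun ε => ⟨hout ε, ?_, ?_⟩⟩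
  · change program.exec H (clampFeature x) (initialState y) = _
    rw [program, Program.exec, e₁, PMF.pure_bind, Program.exec, e₂, PMF.pure_bind, Program.exec,
      e₃, PMF.bind_map]
    change (PMF.uniformOfFintype (Fin n → Bool)).bind
      (fun ε => final.exec H (clampFeature x) (g ε)) = _
    simp only [hG]
    rfl
  · obtain ⟨-, -, -, -, -, -, c6, -⟩ := hg ε
    rw [hcalls, c6, bc, ac]
    rfl
  · obtain ⟨-, -, -, -, -, -, -, c7⟩ := hg ε
    have h0 : (initialState y).time = 0 := rfl
    have := htime ε
    omega

/-- From `2 ^ k ≤ t + 1 < 2 ^ (k + 1)` one gets `a ≤ t ≤ 2 * a` for `a = 2 ^ k - 1`, so there are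
enough past features to serve as ghosts. -/
lemma exists_epoch (t : ℕ) :
    ∃ m n : ℕ, epochStart t + m = t ∧ m + n = epochStart t := by
  have h1 := Nat.pow_log_le_self 2 (x := t + 1) (by omega)
  have h2 := Nat.lt_pow_succ_log_self (b := 2) (by norm_num) (t + 1)
  rw [pow_succ] at h2
  have h3 := Nat.one_le_two_pow (n := Nat.log 2 (t + 1))
  refine ⟨t - epochStart t, epochStart t - (t - epochStart t), ?_, ?_⟩ <;>
    (unfold epochStart; omega)

lemma time_calls_of_mem_support {t : ℕ} {x : Fin (t + 1) → X} {y : Fin t → I} {s : State}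
    (hs : s ∈ (program.run H x y).support) : s.time ≤ 400 * (t + 1) ∧ s.calls = 2 := by
  obtain ⟨m, n, hm, hn⟩ := exists_epoch t
  obtain ⟨g, hg, h⟩ := program_run_eq_map H rfl hm hn x y
  rw [hg, PMF.support_map] at hs
  obtain ⟨ε, -, rfl⟩ := hs
  exact ⟨(h ε).2.2, (h ε).2.1⟩

lemma oracleEfficient_program : Program.OracleEfficient.{u} program := by
  refine ⟨400 * Polynomial.X, fun X H _ t x y s hs => ?_⟩
  simpa using (time_calls_of_mem_support H hs).1

lemma fewOracleCalls_program : Program.FewOracleCalls.{u} program := by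
  -- Two calls are made, and `4 * log 2 > 2` already covers `T = 2`.
  refine ⟨4, fun X H _ T hT t _ x y s hs => ?_⟩
  rw [(time_calls_of_mem_support H hs).2]
  have hT' : (2 : ℝ) ≤ T := by exact_mod_cast hT
  have h1 : 1 ≤ √(T : ℝ) := Real.one_le_sqrt.2 (by linarith)
  have h2 : Real.log 2 ≤ Real.log T := Real.log_le_log (by norm_num) hT'
  have h3 := Real.log_two_gt_d9
  push_cast
  nlinarith

lemma rule_program {t a m n : ℕ} (ha : epochStart t = a) (hm : a + m = t) (hn : m + n = a)
    (x : Fin (t + 1) → X) (y : Fin t → I) :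
    (program.rule H t x y : Measure I) = ((PMF.uniformOfFintype (Fin n → Bool)).map fun ε =>
      equalize (queryValue H (clampFeature x) a m n (extendLabels y) 0 ε)
        (queryValue H (clampFeature x) a m n (extendLabels y) 1 ε)).toMeasure := by
  obtain ⟨g, hg, h⟩ := program_run_eq_map H ha hm hn x y
  change ((program.run H x y).map State.output).toMeasure = _
  rw [hg, PMF.map_comp]
  congr 2
  funext ε
  exact (h ε).1

end Run

/-! ### Averages over signs -/

/-- The average over `n` independent uniform signs. -/
def signAvg (n : ℕ) (F : (Fin n → Bool) → ℝ) : ℝ := (∑ ε, F ε) / 2 ^ n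

section SignAvg

variable {n : ℕ}

lemma signAvg_mono {F G : (Fin n → Bool) → ℝ} (h : ∀ ε, F ε ≤ G ε) :
    signAvg n F ≤ signAvg n G :=
  div_le_div_of_nonneg_right (Finset.sum_le_sum fun ε _ => h ε) (by positivity)

@[simp] lemma signAvg_const (c : ℝ) : signAvg n (fun _ => c) = c := by
  simp [signAvg]

lemma signAvg_add (F G : (Fin n → Bool) → ℝ) :
    signAvg n (fun ε => F ε + G ε) = signAvg n F + signAvg n G := by
  simp [signAvg, Finset.sum_add_distrib, add_div]

lemma signAvg_neg (F : (Fin n → Bool) → ℝ) :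
    signAvg n (fun ε => -F ε) = -signAvg n F := by
  simp [signAvg, neg_div]

lemma signAvg_cons (F : (Fin (n + 1) → Bool) → ℝ) :
    signAvg (n + 1) F =
      signAvg n fun ε => (F (Fin.cons true ε) + F (Fin.cons false ε)) / 2 := by
  simp only [signAvg, ← (Fin.consEquiv fun _ : Fin (n + 1) => Bool).sum_comp,
    Fintype.sum_prod_type, Fintype.sum_bool, ← Finset.sum_add_distrib, ← Finset.sum_div,
    Fin.consEquiv, Equiv.coe_fn_mk]
  rw [pow_succ']
  field_simp

lemma signAvg_not (F : (Fin n → Bool) → ℝ) :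
    signAvg n (fun ε => F fun i => !ε i) = signAvg n F := by
  simp only [signAvg]
  congr 1
  exact Equiv.sum_comp (Equiv.arrowCongr (Equiv.refl (Fin n)) Equiv.boolNot) F

lemma sgn_not (b : Bool) : sgn (!b) = -sgn b := by cases b <;> simp [sgn]

lemma abs_sgn (b : Bool) : |sgn b| = 1 := by cases b <;> simp [sgn]

lemma signAvg_sum_sgn_mul (v : Fin n → ℝ) : signAvg n (fun ε => ∑ i, sgn (ε i) * v i) = 0 := by
  have h := signAvg_not fun ε : Fin n → Bool => ∑ i, sgn (ε i) * v i
  simp only [sgn_not, neg_mul, Finset.sum_neg_distrib, signAvg_neg] at h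
  linarith

lemma integral_uniformOfFintype_map (φ : (Fin n → Bool) → I) {g : I → ℝ} (hg : Continuous g) :
    ∫ v, g v ∂((PMF.uniformOfFintype (Fin n → Bool)).map φ).toMeasure =
      signAvg n fun ε => g (φ ε) := by
  let _ : MeasurableSpace (Fin n → Bool) := ⊤
  have : MeasurableSingletonClass (Fin n → Bool) := ⟨fun _ => trivial⟩
  rw [← PMF.toMeasure_map _ _ (measurable_of_finite φ),
    integral_map (measurable_of_finite φ).aemeasurable hg.aestronglyMeasurable,
    PMF.integral_eq_sum]
  simp [signAvg, div_eq_inv_mul, Finset.mul_sum]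

end SignAvg

/-! ### The value of the ERM task -/

section ERM

variable {X : Type u} {H : Set (X → I)}

lemma abs_sub_le_one (a b : I) : |(a : ℝ) - b| ≤ 1 := by
  rw [abs_le]
  constructor <;> linarith [a.2.1, a.2.2, b.2.1, b.2.2]

lemma abs_sum_sgn_mul_le {n : ℕ} (ε : Fin n → Bool) (v : Fin n → I) :
    |∑ j, sgn (ε j) * (v j : ℝ)| ≤ n := by
  refine (Finset.abs_sum_le_sum_abs _ _).trans ?_
  refine (Finset.sum_le_card_nsmul _ _ 1 fun j _ => ?_).trans (by simp)
  rw [abs_mul, abs_sgn, one_mul, abs_of_nonneg (v j).2.1]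
  exact (v j).2.2

section

variable {m n : ℕ} (x : Fin m → X) (y : Fin m → I) (C : ℝ≥0) (ε : Fin n → Bool) (x' : Fin n → X)

lemma abs_ermObjective_le (h : X → I) :
    |∑ i, |(h (x i) : ℝ) - y i| + C * ∑ j, sgn (ε j) * (h (x' j) : ℝ)| ≤ m + C * n := by
  refine (abs_add_le _ _).trans (add_le_add ?_ ?_)
  · rw [abs_of_nonneg (Finset.sum_nonneg fun _ _ => abs_nonneg _)]
    exact (Finset.sum_le_card_nsmul _ _ 1 fun j _ => abs_sub_le_one _ _).trans (by simp)
  · rw [abs_mul, abs_of_nonneg C.coe_nonneg]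
    gcongr
    exact abs_sum_sgn_mul_le ε fun j => h (x' j)

lemma mixedERM_le (h : H) :
    mixedERM H x y C ε x' ≤ ∑ i, |(h.1 (x i) : ℝ) - y i| + C * ∑ j, sgn (ε j) * h.1 (x' j) := by
  refine ciInf_le ⟨-(m + C * n : ℝ), ?_⟩ h
  rintro _ ⟨h, rfl⟩
  exact (abs_le.1 (abs_ermObjective_le x y C ε x' h.1)).1

lemma abs_mixedERM_le (hH : H.Nonempty) : |mixedERM H x y C ε x'| ≤ m + C * n := by
  have := hH.to_subtype
  rw [abs_le]
  constructor
  · exact le_ciInf fun h => (abs_le.1 (abs_ermObjective_le x y C ε x' h.1)).1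
  · obtain ⟨h, hh⟩ := hH
    exact (mixedERM_le x y C ε x' ⟨h, hh⟩).trans
      (abs_le.1 (abs_ermObjective_le x y C ε x' h)).2

lemma mixedERM_le_add (hH : H.Nonempty) (y' : Fin m → I) :
    mixedERM H x y C ε x' ≤ mixedERM H x y' C ε x' + m * dist y y' := by
  have := hH.to_subtype
  rw [← sub_le_iff_le_add]
  refine le_ciInf fun h => ?_
  rw [sub_le_iff_le_add]
  refine (mixedERM_le x y C ε x' h).trans ?_
  have : ∑ i, |(h.1 (x i) : ℝ) - y i| ≤ ∑ i, (|(h.1 (x i) : ℝ) - y' i| + dist y y') := by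
    refine Finset.sum_le_sum fun i _ => ?_
    have h1 : |(y' i : ℝ) - y i| ≤ dist y y' := by
      rw [abs_sub_comm]
      exact dist_le_pi_dist y y' i
    exact (abs_sub_le _ (y' i : ℝ) _).trans (add_le_add le_rfl h1)
  rw [Finset.sum_add_distrib] at this
  simp only [Finset.sum_const, Finset.card_univ, Fintype.card_fin, nsmul_eq_mul] at this
  linarith

lemma continuous_mixedERM (hH : H.Nonempty) :
    Continuous fun y : Fin m → I => mixedERM H x y C ε x' := by
  refine (LipschitzWith.of_dist_le_mul (K := m) fun y y' => ?_).continuous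
  rw [Real.dist_eq, abs_le, NNReal.coe_natCast]
  have h1 := mixedERM_le_add x y C ε x' hH y'
  have h2 := mixedERM_le_add x y' C ε x' hH y
  rw [dist_comm] at h2
  constructor <;> linarith

end

lemma measurable_of_continuous_of_measurable {ι Ω Ω' : Type*} [TopologicalSpace ι]
    [TopologicalSpace.MetrizableSpace ι] [MeasurableSpace ι] [SecondCountableTopology ι]
    [OpensMeasurableSpace ι] [MeasurableSpace Ω] [MeasurableSpace Ω'] {u : ι → Ω' → ℝ}
    (hu : ∀ ω, Continuous fun i => u i ω) (hu' : ∀ i, Measurable (u i)) {y : Ω → ι} {p : Ω → Ω'}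
    (hy : Measurable y) (hp : Measurable p) : Measurable fun ω => u (y ω) (p ω) :=
  (measurable_uncurry_of_continuous_of_measurable hu hu').comp (hy.prodMk hp)

/-- `MeasurableERM` fixes the labels, but in the regret they vary with the features. The value is
Lipschitz in the labels, and a function continuous in one variable and measurable in the other is
jointly measurable. -/
lemma measurable_mixedERM [MeasurableSpace X] (hH : H.Nonempty) (hM : MeasurableERM H)
    {Ω : Type*} [MeasurableSpace Ω] {m n : ℕ} {x : Ω → Fin m → X} {y : Ω → Fin m → I} (C : ℝ≥0)
    (ε : Fin n → Bool) {x' : Ω → Fin n → X} (hx : Measurable x) (hy : Measurable y)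
    (hx' : Measurable x') : Measurable fun ω => mixedERM H (x ω) (y ω) C ε (x' ω) := by
  obtain ⟨u, hu⟩ : ∃ u : (Fin m → I) → (Fin m → X) × (Fin n → X) → ℝ,
      ∀ y p, u y p = mixedERM H p.1 y C ε p.2 := ⟨_, fun _ _ => rfl⟩
  have h1 : ∀ p, Continuous fun y => u y p := fun p => by
    simpa only [hu] using continuous_mixedERM p.1 C ε p.2 hH
  have h2 : ∀ y, Measurable (u y) := fun y => by
    rw [show u y = _ from funext (hu y)]
    exact hM m n y C ε
  simpa only [hu] using measurable_of_continuous_of_measurable h1 h2 hy (hx.prodMk hx')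

lemma bddAbove_rademacher (hH : H.Nonempty) (T : ℕ) : BddAbove (Set.range fun x : Fin T → X =>
    signAvg T fun ε => ⨆ h : H, ∑ t, sgn (ε t) * (h.1 (x t) : ℝ)) := by
  have := hH.to_subtype
  refine ⟨T, ?_⟩
  rintro _ ⟨x, rfl⟩
  refine (signAvg_mono fun ε => ciSup_le fun h => ?_).trans (signAvg_const (n := T) (T : ℝ)).le
  exact (abs_le.1 (abs_sum_sgn_mul_le ε fun t => h.1 (x t))).2

/-- Without labelled examples, minus an infimum is a supremum with all signs flipped; uniform signs
are invariant under the flip, which yields the Rademacher average. -/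
lemma neg_mixedERM_eq_iSup {n : ℕ} (x : Fin 0 → X) (y : Fin 0 → I) (ε : Fin n → Bool)
    (x' : Fin n → X) :
    -mixedERM H x y 1 ε x' = ⨆ h : H, ∑ t, sgn (!ε t) * (h.1 (x' t) : ℝ) := by
  simp only [mixedERM, Finset.univ_eq_empty, Finset.sum_empty, zero_add, NNReal.coe_one, one_mul,
    sgn_not, neg_mul, Finset.sum_neg_distrib]
  rw [iInf, Real.sInf_def, neg_neg, iSup]
  congr 1
  ext r
  simp only [Set.mem_neg, Set.mem_range]
  exact exists_congr fun h => ⟨fun e => by linarith, fun e => by linarith⟩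

lemma signAvg_neg_mixedERM_le_rademacher (hH : H.Nonempty) {n : ℕ} (x : Fin 0 → X)
    (y : Fin 0 → I) (z : Fin n → X) :
    signAvg n (fun ε => -mixedERM H x y 1 ε z) ≤ rademacher H n := by
  simp only [neg_mixedERM_eq_iSup]
  rw [signAvg_not fun ε : Fin n → Bool => ⨆ h : H, ∑ t, sgn (ε t) * (h.1 (z t) : ℝ)]
  exact le_ciSup (bddAbove_rademacher hH n) z

/-- The prediction `equalize` balances the two extreme labels, so that no label does more harm
than a random sign. -/
lemma abs_equalize_sub_le {ι : Type*} [Nonempty ι] (Q : ι → ℝ) (u : ι → I)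
    (hQ : BddBelow (Set.range Q)) (b : I) :
    |(equalize (⨅ h, (Q h + |(u h : ℝ) - (0 : I)|)) (⨅ h, (Q h + |(u h : ℝ) - (1 : I)|)) : ℝ) - b| -
        ⨅ h, (Q h + |(u h : ℝ) - b|) ≤
      (-(⨅ h, (Q h + u h)) + -(⨅ h, (Q h - u h))) / 2 := by
  obtain ⟨c, hc⟩ := hQ
  have hc' : ∀ h, c ≤ Q h := fun h => hc ⟨h, rfl⟩
  have hb : ∀ r : ι → ℝ, (∀ h, -1 ≤ r h) → BddBelow (Set.range fun h => Q h + r h) := by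
    rintro r hr
    refine ⟨c - 1, ?_⟩
    rintro _ ⟨h, rfl⟩
    linarith [hc' h, hr h]
  set A := ⨅ h, (Q h + u h) with hA
  set B := ⨅ h, (Q h - u h) with hB
  have hA' : ∀ h, A ≤ Q h + u h := fun h =>
    ciInf_le (hb (fun h => (u h : ℝ)) fun h => by linarith [(u h).2.1]) h
  have hB' : ∀ h, B ≤ Q h - u h := fun h =>
    ciInf_le (f := fun h => Q h - (u h : ℝ))
      (hb (fun h => -(u h : ℝ)) fun h => by linarith [(u h).2.2]) h
  have e0 : ⨅ h, (Q h + |(u h : ℝ) - (0 : I)|) = A := by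
    rw [hA]
    congr 1
    funext h
    simp [abs_of_nonneg (u h).2.1]
  have e1 : ⨅ h, (Q h + |(u h : ℝ) - (1 : I)|) = 1 + B := by
    have : ∀ h, Q h + |(u h : ℝ) - (1 : I)| = 1 + (Q h - u h) := fun h => by
      rw [abs_sub_comm, abs_of_nonneg (by simpa using (u h).2.2), Set.Icc.coe_one]
      ring
    simp only [this]
    refine le_antisymm ?_ (le_ciInf fun h => by linarith [hB' h])
    rw [← sub_le_iff_le_add']
    refine le_ciInf fun h => ?_
    rw [sub_le_iff_le_add']
    exact ciInf_le (f := fun h => 1 + (Q h - (u h : ℝ))) ⟨1 + B, by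
      rintro _ ⟨h, rfl⟩
      linarith [hB' h]⟩ h
  rw [e0, e1]
  -- `B ≤ A ≤ B + 2` puts `(A - B) / 2` in `[0,1]`, so the clamping in `equalize` has no effect.
  have hAB : A ≤ 1 + (1 + B) := by
    rw [← sub_le_iff_le_add', ← sub_le_iff_le_add']
    exact le_ciInf fun h => by linarith [hA' h, (u h).2.2]
  have hBA : B ≤ A := le_ciInf fun h => by
    linarith [hB' h, (u h).2.1]
  have hv : ((equalize A (1 + B) : I) : ℝ) = (A - B) / 2 := by
    rw [equalize, Set.projIcc_of_mem zero_le_one (by constructor <;> linarith)]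
    ring
  -- For `v = (A - B) / 2`, the sum `|v - b| + (A + B) / 2` equals `A - b` if `b ≤ v` and `B + b`
  -- otherwise; these are at most `Q + (u - b)` and `Q + (b - u)`.
  rw [hv, sub_le_iff_le_add, ← sub_le_iff_le_add']
  refine le_ciInf fun h => ?_
  have h1 := hA' h
  have h2 := hB' h
  have hu0 := (u h).2.1
  have hu1 := (u h).2.2
  have hb0 := b.2.1
  have hb1 := b.2.2
  rcases abs_cases ((u h : ℝ) - b) with ⟨e, _⟩ | ⟨e, _⟩ <;>
  rcases abs_cases ((A - B) / 2 - (b : ℝ)) with ⟨e', _⟩ | ⟨e', _⟩ <;>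
  rw [e, e'] <;> linarith

end ERM

/-! ### The regret of the program -/

section Regret

variable {X : Type u} {H : Set (X → I)}

lemma signAvg_measurable {Ω : Type*} [MeasurableSpace Ω] {n : ℕ} {F : (Fin n → Bool) → Ω → ℝ}
    (h : ∀ ε, Measurable (F ε)) : Measurable fun ω => signAvg n fun ε => F ε ω :=
  (Finset.measurable_sum _ fun ε _ => h ε).div_const _

/-- The value of the ERM task before the round `a + m`, with the current feature added to the
signed features. -/
def preValue (H : Set (X → I)) (x : ℕ → X) (a m n : ℕ) (y : ℕ → I) (ε : Fin (n + 1) → Bool) : ℝ :=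
  mixedERM H (fun i : Fin m => x (a + i)) (fun i : Fin m => y (a + i)) 1 ε
    (Fin.cons (x (a + m)) fun i : Fin n => x (m + i))

/-- The prediction in the round `a + m`, for the signs `ε`. -/
def prediction (H : Set (X → I)) (x : ℕ → X) (a m n : ℕ) (y : ℕ → I) (ε : Fin n → Bool) : I :=
  equalize (queryValue H x a m n y 0 ε) (queryValue H x a m n y 1 ε)

/-- The least cumulative loss of an expert in the rounds `a, …, a + m - 1`. -/
def leastLoss (H : Set (X → I)) (x : ℕ → X) (y : ℕ → I) (a m : ℕ) : ℝ :=
  ⨅ h : H, ∑ i : Fin m, |(h.1 (x (a + i)) : ℝ) - y (a + i)|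

lemma leastLoss_eq_mixedERM (x : ℕ → X) (y : ℕ → I) (a m : ℕ) :
    leastLoss H x y a m = mixedERM H (fun i : Fin m => x (a + i)) (fun i : Fin m => y (a + i)) 1
      (Fin.elim0 : Fin 0 → Bool) (Fin.elim0 : Fin 0 → X) := by
  simp [leastLoss, mixedERM]

lemma abs_queryValue_le (hH : H.Nonempty) (x : ℕ → X) (a m n : ℕ) (y : ℕ → I) (b : I)
    (ε : Fin n → Bool) : |queryValue H x a m n y b ε| ≤ m + 1 + n := by
  refine (abs_mixedERM_le _ _ _ _ _ hH).trans (le_of_eq ?_)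
  simp

lemma abs_preValue_le (hH : H.Nonempty) (x : ℕ → X) (a m n : ℕ) (y : ℕ → I)
    (ε : Fin (n + 1) → Bool) : |preValue H x a m n y ε| ≤ m + (n + 1) := by
  refine (abs_mixedERM_le _ _ _ _ _ hH).trans (le_of_eq ?_)
  simp

lemma abs_leastLoss_le (hH : H.Nonempty) (x : ℕ → X) (a m : ℕ) (y : ℕ → I) :
    |leastLoss H x y a m| ≤ m := by
  rw [leastLoss_eq_mixedERM]
  refine (abs_mixedERM_le _ _ _ _ _ hH).trans (le_of_eq ?_)
  simp

/-- One round of the potential argument: with the other signs fixed, averaging over the sign of the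
current feature is precisely the right-hand side of `abs_equalize_sub_le`. This holds for each
feature sequence, with no distributional assumption. -/
lemma signAvg_round (hH : H.Nonempty) (x : ℕ → X) (a m n : ℕ) (y : ℕ → I) :
    signAvg n (fun ε => |(prediction H x a m n y ε : ℝ) - y (a + m)|) +
        signAvg n (fun ε => -queryValue H x a m n y (y (a + m)) ε) ≤
      signAvg (n + 1) fun ε => -preValue H x a m n y ε := by
  have := hH.to_subtype
  rw [signAvg_cons, ← signAvg_add]
  refine signAvg_mono fun ε => ?_
  set Q : H → ℝ := fun h => ∑ i : Fin m, |(h.1 (x (a + i)) : ℝ) - y (a + i)| +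
    ∑ j : Fin n, sgn (ε j) * (h.1 (x (m + j)) : ℝ) with hQ
  have h1 : ∀ b, queryValue H x a m n y b ε = ⨅ h, (Q h + |((h.1 (x (a + m)) : I) : ℝ) - b|) := by
    intro b
    unfold queryValue mixedERM
    congr 1
    funext h
    simp only [Fin.sum_univ_castSucc, Fin.snoc_castSucc, Fin.snoc_last, Fin.val_castSucc,
      Fin.val_last, NNReal.coe_one, one_mul, hQ]
    ring
  have h2 : preValue H x a m n y (Fin.cons true ε) = ⨅ h, (Q h + (h.1 (x (a + m)) : I)) := by
    unfold preValue mixedERM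
    congr 1
    funext h
    simp only [Fin.sum_univ_succ, Fin.cons_zero, Fin.cons_succ, NNReal.coe_one, one_mul, hQ, sgn,
      if_true]
    ring
  have h3 : preValue H x a m n y (Fin.cons false ε) = ⨅ h, (Q h - (h.1 (x (a + m)) : I)) := by
    unfold preValue mixedERM
    congr 1
    funext h
    simp only [Fin.sum_univ_succ, Fin.cons_zero, Fin.cons_succ, NNReal.coe_one, one_mul, hQ, sgn,
      Bool.false_eq_true, if_false]
    ring
  rw [h2, h3, prediction, h1, h1, h1, ← sub_eq_add_neg]
  refine abs_equalize_sub_le Q (fun h => h.1 (x (a + m))) ⟨-(m + (1 : ℝ≥0) * n : ℝ), ?_⟩ _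
  rintro _ ⟨h, rfl⟩
  have := (abs_le.1 (abs_ermObjective_le (fun i : Fin m => x (a + i)) (fun i : Fin m => y (a + i))
    1 ε (fun j : Fin n => x (m + j)) h.1)).1
  simpa [hQ] using this

/-- Each expert's signed sum averages to zero. This discards the remaining ghosts when the horizon
falls inside an epoch. -/
lemma signAvg_queryValue_le (x : ℕ → X) (a m n : ℕ) (y : ℕ → I) (h : H) :
    signAvg n (fun ε => queryValue H x a m n y (y (a + m)) ε) ≤
      ∑ i : Fin (m + 1), |(h.1 (x (a + i)) : ℝ) - y (a + i)| := by
  refine (signAvg_mono fun ε => mixedERM_le _ _ _ _ _ h).trans ?_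
  rw [signAvg_add, signAvg_const]
  simp only [NNReal.coe_one, one_mul]
  rw [signAvg_sum_sgn_mul fun j : Fin n => (h.1 (x (m + j)) : ℝ), add_zero,
    Fin.sum_univ_castSucc, Fin.sum_univ_castSucc]
  simp

/-- A single expert cannot beat the blockwise best ones; hence restarting the algorithm at each
epoch only strengthens the benchmark. -/
lemma leastLoss_add_le (hH : H.Nonempty) (x : ℕ → X) (y : ℕ → I) (a m : ℕ) :
    leastLoss H x y 0 a + leastLoss H x y a m ≤ leastLoss H x y 0 (a + m) := by
  have := hH.to_subtype
  refine le_ciInf fun h => ?_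
  rw [Fin.sum_univ_eq_sum_range (fun i => |(h.1 (x (0 + i)) : ℝ) - y (0 + i)|),
    Finset.sum_range_add]
  refine add_le_add ?_ ?_
  · refine (ciInf_le ⟨0, ?_⟩ h).trans
      (Fin.sum_univ_eq_sum_range (fun i => |(h.1 (x (0 + i)) : ℝ) - y (0 + i)|) _).le
    rintro _ ⟨h, rfl⟩
    exact Finset.sum_nonneg fun _ _ => abs_nonneg _
  · simp only [zero_add]
    refine (ciInf_le ⟨0, ?_⟩ h).trans
      (Fin.sum_univ_eq_sum_range (fun i => |(h.1 (x (a + i)) : ℝ) - y (a + i)|) _).le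
    rintro _ ⟨h, rfl⟩
    exact Finset.sum_nonneg fun _ _ => abs_nonneg _

/-- The expected loss in the round `t`, for the features `x` and the labels `y`. -/
def roundLoss (H : Set (X → I)) (x : ℕ → X) (y : ℕ → I) (t : ℕ) : ℝ :=
  ∫ v, |(v : ℝ) - y t| ∂(Playout.program.rule H t (fun s => x s) (fun s => y s) : Measure I)

/-- The queries use features of index at most `a + m` and labels of index below `a + m`, so the
clamped indices and default labels never intervene. -/
lemma roundLoss_eq_signAvg (x : ℕ → X) (y : ℕ → I) {a m n : ℕ} (ha : epochStart (a + m) = a)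
    (hn : m + n = a) :
    roundLoss H x y (a + m) =
      signAvg n fun ε => |(prediction H x a m n y ε : ℝ) - y (a + m)| := by
  rw [roundLoss, rule_program H ha rfl hn, integral_uniformOfFintype_map _ (by fun_prop)]
  have key : ∀ b ε, queryValue H (clampFeature fun s : Fin (a + m + 1) => x s) a m n
      (extendLabels fun s : Fin (a + m) => y s) b ε = queryValue H x a m n y b ε := by
    intro b ε
    unfold queryValue
    congr 1
    · funext i
      simp only [clampFeature]
      congr 1
      omega
    · congr 1
      funext i
      rw [extendLabels, dif_pos (by omega)]
    · funext i
      simp only [clampFeature]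
      congr 1
      omega
  simp only [key, prediction]

end Regret

/-! ### Measurability and integrability over infinite feature sequences. -/

section Expectation

variable {X : Type u} [MeasurableSpace X] {H : Set (X → I)}

/-- The labels `fₜ(xₜ)`. -/
def labels (f : ℕ → X → I) (x : ℕ → X) (t : ℕ) : I := f t (x t)

lemma integrable_signAvg (P : Measure (ℕ → X)) [IsProbabilityMeasure P] {n : ℕ} {F :
    (Fin n → Bool) → (ℕ → X) → ℝ} (C : ℝ)
    (h : ∀ ε, Measurable (F ε)) (hC : ∀ ε x, |F ε x| ≤ C) :
    Integrable (fun x => signAvg n fun ε => F ε x) P := by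
  refine Integrable.of_bound (signAvg_measurable h).aestronglyMeasurable C (ae_of_all _ fun x => ?_)
  rw [Real.norm_eq_abs, abs_le]
  constructor
  · rw [← signAvg_const (n := n) (-C)]
    exact signAvg_mono fun ε => (abs_le.1 (hC ε x)).1
  · rw [← signAvg_const (n := n) C]
    exact signAvg_mono fun ε => (abs_le.1 (hC ε x)).2

variable {f : ℕ → X → I}

lemma measurable_labels (hf : ∀ t, Measurable (f t)) : Measurable (labels f) :=
  measurable_pi_lambda _ fun t => (hf t).comp (measurable_pi_apply t)

lemma measurable_queryValue (hf : ∀ t, Measurable (f t)) (hH : H.Nonempty)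
    (hM : MeasurableERM H) (a m n : ℕ) (b : (ℕ → X) → I) (hb : Measurable b)
    (ε : Fin n → Bool) :
    Measurable fun x => queryValue H x a m n (labels f x) (b x) ε := by
  refine measurable_mixedERM hH hM _ _ (measurable_pi_lambda _ fun i => measurable_pi_apply _)
    (measurable_pi_lambda _ fun i => ?_) (measurable_pi_lambda _ fun i => measurable_pi_apply _)
  induction i using Fin.lastCases with
  | last => simpa using hb
  | cast i =>
    simp only [Fin.snoc_castSucc]
    exact (measurable_pi_apply _).comp (measurable_labels hf)

lemma measurable_preValue (hf : ∀ t, Measurable (f t)) (hH : H.Nonempty)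
    (hM : MeasurableERM H) (a m n : ℕ) (ε : Fin (n + 1) → Bool) :
    Measurable fun x => preValue H x a m n (labels f x) ε := by
  refine measurable_mixedERM hH hM _ _ (measurable_pi_lambda _ fun i => measurable_pi_apply _)
    (measurable_pi_lambda _ fun i => (measurable_pi_apply _).comp (measurable_labels hf))
    (measurable_pi_lambda _ fun i => ?_)
  induction i using Fin.cases with
  | zero => simpa using measurable_pi_apply _
  | succ i => simpa using measurable_pi_apply _

lemma measurable_leastLoss (hf : ∀ t, Measurable (f t)) (hH : H.Nonempty)
    (hM : MeasurableERM H) (a m : ℕ) :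
    Measurable fun x => leastLoss H x (labels f x) a m := by
  simp only [leastLoss_eq_mixedERM]
  exact measurable_mixedERM hH hM _ _ (measurable_pi_lambda _ fun i => measurable_pi_apply _)
    (measurable_pi_lambda _ fun i => (measurable_pi_apply _).comp (measurable_labels hf))
    measurable_const

lemma measurable_roundLoss (hf : ∀ t, Measurable (f t)) (hH : H.Nonempty)
    (hM : MeasurableERM H) (t : ℕ) :
    Measurable fun x => roundLoss H x (labels f x) t := by
  obtain ⟨m, n, hm, hn⟩ := exists_epoch t
  have ha : epochStart (epochStart t + m) = epochStart t := by rw [hm]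
  rw [← hm]
  simp only [roundLoss_eq_signAvg _ _ ha hn]
  refine signAvg_measurable fun ε => ?_
  have h0 := measurable_queryValue hf hH hM (epochStart t) m n (fun _ => 0) measurable_const ε
  have h1 := measurable_queryValue hf hH hM (epochStart t) m n (fun _ => 1) measurable_const ε
  have h2 : Measurable fun x => prediction H x (epochStart t) m n (labels f x) ε :=
    continuous_projIcc.measurable.comp (((measurable_const.add h0).sub h1).div_const 2)
  have h3 : Measurable fun x => labels f x (epochStart t + m) :=
    (measurable_pi_apply _).comp (measurable_labels hf)
  exact (continuous_abs.measurable).comp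
    ((measurable_subtype_coe.comp h2).sub (measurable_subtype_coe.comp h3))

lemma integrable_leastLoss (hf : ∀ t, Measurable (f t)) (hH : H.Nonempty)
    (hM : MeasurableERM H) (P : Measure (ℕ → X)) [IsProbabilityMeasure P] (a m : ℕ) :
    Integrable (fun x => leastLoss H x (labels f x) a m) P := by
  refine Integrable.of_bound (measurable_leastLoss hf hH hM a m).aestronglyMeasurable m
    (ae_of_all _ fun x => abs_leastLoss_le hH x a m _)

lemma integrable_roundLoss (hf : ∀ t, Measurable (f t)) (hH : H.Nonempty)
    (hM : MeasurableERM H) (P : Measure (ℕ → X)) [IsProbabilityMeasure P] (t : ℕ) :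
    Integrable (fun x => roundLoss H x (labels f x) t) P := by
  refine Integrable.of_bound (measurable_roundLoss hf hH hM t).aestronglyMeasurable 1
    (ae_of_all _ fun x => ?_)
  refine (norm_integral_le_of_norm_le_const (C := 1) (ae_of_all _ fun v => ?_)).trans (by simp)
  rw [Real.norm_eq_abs, abs_abs]
  exact abs_sub_le_one _ _

lemma integrable_postValue (hf : ∀ t, Measurable (f t)) (hH : H.Nonempty)
    (hM : MeasurableERM H) (P : Measure (ℕ → X)) [IsProbabilityMeasure P] (a m n : ℕ) :
    Integrable (fun x => signAvg n fun ε =>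
      -queryValue H x a m n (labels f x) (labels f x (a + m)) ε) P := by
  have hb : Measurable fun x => labels f x (a + m) :=
    (measurable_pi_apply _).comp (measurable_labels hf)
  refine integrable_signAvg P (m + 1 + n) (fun ε =>
    (measurable_queryValue hf hH hM a m n (fun x => labels f x (a + m)) hb ε).neg) fun ε x => ?_
  rw [abs_neg]
  exact abs_queryValue_le hH x a m n _ _ ε

lemma integrable_preValue (hf : ∀ t, Measurable (f t)) (hH : H.Nonempty)
    (hM : MeasurableERM H) (P : Measure (ℕ → X)) [IsProbabilityMeasure P] (a m n : ℕ) :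
    Integrable (fun x => signAvg (n + 1) fun ε => -preValue H x a m n (labels f x) ε) P := by
  refine integrable_signAvg P (m + (n + 1)) (fun ε =>
    (measurable_preValue hf hH hM a m n ε).neg) fun ε x => ?_
  rw [abs_neg]
  exact abs_preValue_le hH x a m n _ ε

end Expectation

/-! ### Exchangeability, telescoping within an epoch, and summation over epochs. -/

section Total

variable {X : Type u} [MeasurableSpace X] {H : Set (X → I)} {f : ℕ → X → I}

open Measure

lemma measurePreserving_comp_infinitePi (μ : Measure X) [IsProbabilityMeasure μ] {ι κ : Type*}
    {g : κ → ι} (hg : Function.Injective g) :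
    MeasurePreserving (fun (x : ι → X) i => x (g i)) (infinitePi fun _ : ι => μ)
      (infinitePi fun _ : κ => μ) :=
  ⟨by fun_prop, map_infinitePi_infinitePi_of_inj hg⟩

/-- The current feature of the next round is exchangeable with the past feature that is no longer
needed. -/
lemma integral_postValue_eq (hf : ∀ t, Measurable (f t)) (hH : H.Nonempty)
    (hM : MeasurableERM H) (μ : Measure X) [IsProbabilityMeasure μ]
    {a m n : ℕ} (h : m + n + 1 = a) :
    ∫ x, signAvg (n + 1) (fun ε => -queryValue H x a m (n + 1) (labels f x)
        (labels f x (a + m)) ε) ∂(infinitePi fun _ : ℕ => μ) =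
      ∫ x, signAvg (n + 1) (fun ε => -preValue H x a (m + 1) n (labels f x) ε)
        ∂(infinitePi fun _ : ℕ => μ) := by
  have hmp := measurePreserving_comp_infinitePi μ (Equiv.swap m (a + m + 1)).injective
  have h1 := (integrable_preValue hf hH hM (infinitePi fun _ : ℕ => μ)
    a (m + 1) n).aestronglyMeasurable
  rw [← hmp.map_eq] at h1
  have h2 := integral_map hmp.measurable.aemeasurable h1
  rw [hmp.map_eq] at h2
  rw [h2]
  congr 1
  funext x
  congr 1
  funext ε
  congr 1
  -- The transposition moves only `m < a` and `a + m + 1`, so it fixes the labelled rounds `a, …, a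
  -- + m` and their labels `f_t(x_t)`. Obliviousness enters here: labels depending on earlier
  -- features could change.
  have hs : ∀ i, i ≠ m → i ≠ a + m + 1 → Equiv.swap m (a + m + 1) i = i := fun i h1 h2 =>
    Equiv.swap_apply_of_ne_of_ne h1 h2
  unfold queryValue preValue
  congr 1
  · funext i
    simp only [hs (a + i) (by omega) (by omega)]
  · funext i
    induction i using Fin.lastCases with
    | last => simp [labels, hs (a + m) (by omega) (by omega)]
    | cast i => simp [labels, hs (a + i) (by omega) (by omega)]
  · funext i
    induction i using Fin.cases with
    | zero =>
      have : a + (m + 1) = a + m + 1 := by ring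
      simp [this]
    | succ i =>
      have := i.isLt
      simp only [Fin.val_succ, Fin.cons_succ]
      rw [hs (m + 1 + i) (by omega) (by omega)]
      congr 1
      ring

/-- Each round turns the pre-value into loss plus post-value, and exchangeability identifies the
post-value with the next pre-value in expectation. At the start of the epoch nothing is labelled,
and the pre-value is a Rademacher average of `a + 1` points. -/
lemma integral_epoch_le (hf : ∀ t, Measurable (f t)) (hH : H.Nonempty)
    (hM : MeasurableERM H) (μ : Measure X) [IsProbabilityMeasure μ]
    {a : ℕ} (ha : ∀ m ≤ a, epochStart (a + m) = a) {m n : ℕ}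
    (hn : m + n = a) :
    (∑ i ∈ Finset.range (m + 1), ∫ x, roundLoss H x (labels f x) (a + i)
        ∂(infinitePi fun _ : ℕ => μ)) +
      ∫ x, signAvg n (fun ε => -queryValue H x a m n (labels f x) (labels f x (a + m)) ε)
        ∂(infinitePi fun _ : ℕ => μ) ≤ rademacher H (a + 1) := by
  have hround : ∀ m n, m + n = a → ∫ x, roundLoss H x (labels f x) (a + m)
        ∂(infinitePi fun _ : ℕ => μ) +
      ∫ x, signAvg n (fun ε => -queryValue H x a m n (labels f x) (labels f x (a + m)) ε)
        ∂(infinitePi fun _ : ℕ => μ) ≤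
      ∫ x, signAvg (n + 1) (fun ε => -preValue H x a m n (labels f x) ε)
        ∂(infinitePi fun _ : ℕ => μ) := by
    intro m n hn
    have i1 := integrable_roundLoss hf hH hM (infinitePi fun _ : ℕ => μ) (a + m)
    have i2 := integrable_postValue hf hH hM (infinitePi fun _ : ℕ => μ) a m n
    rw [← integral_add i1 i2]
    refine integral_mono (i1.add i2)
      (integrable_preValue hf hH hM (infinitePi fun _ : ℕ => μ) a m n) fun x => ?_
    rw [roundLoss_eq_signAvg x _ (ha m (by omega)) hn]
    exact signAvg_round hH x a m n _
  induction m generalizing n with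
  | zero =>
    obtain rfl : n = a := by omega
    rw [Finset.sum_range_one]
    refine (hround 0 n hn).trans ?_
    refine (integral_mono (integrable_preValue hf hH hM (infinitePi fun _ : ℕ => μ) n 0 n)
      (integrable_const (rademacher H (n + 1))) fun x => ?_).trans (by simp)
    exact signAvg_neg_mixedERM_le_rademacher hH _ _ _
  | succ m ih =>
    rw [Finset.sum_range_succ]
    have h1 := ih (n := n + 1) (by omega)
    have h2 := hround (m + 1) n hn
    rw [integral_postValue_eq hf hH hM μ (by omega)] at h1
    linarith

/-- The expected regret after `T` rounds. -/
def totalRegret (H : Set (X → I)) (f : ℕ → X → I) (P : Measure (ℕ → X)) (T : ℕ) : ℝ :=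
  (∑ t ∈ Finset.range T, ∫ x, roundLoss H x (labels f x) t ∂P) -
    ∫ x, leastLoss H x (labels f x) 0 T ∂P

/-- It is stated for every initial part of an epoch, so that a horizon inside an epoch costs no more
than the full epoch. -/
lemma totalRegret_epoch_le (hf : ∀ t, Measurable (f t)) (hH : H.Nonempty)
    (hM : MeasurableERM H) (μ : Measure X) [IsProbabilityMeasure μ]
    {a m : ℕ} (ha : ∀ m ≤ a, epochStart (a + m) = a) (hm : m ≤ a) :
    totalRegret H f (infinitePi fun _ : ℕ => μ) (a + (m + 1)) ≤
      totalRegret H f (infinitePi fun _ : ℕ => μ) a + rademacher H (a + 1) := by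
  have := hH.to_subtype
  obtain ⟨n, hn⟩ := Nat.exists_eq_add_of_le hm
  have h1 := integral_epoch_le hf hH hM μ ha hn.symm
  have i0 := fun a m => integrable_leastLoss hf hH hM (infinitePi fun _ : ℕ => μ) a m
  have h2 : ∫ x, -leastLoss H x (labels f x) a (m + 1) ∂(infinitePi fun _ : ℕ => μ) ≤
      ∫ x, signAvg n (fun ε => -queryValue H x a m n (labels f x) (labels f x (a + m)) ε)
        ∂(infinitePi fun _ : ℕ => μ) := by
    refine integral_mono (i0 _ _).neg (integrable_postValue hf hH hM _ a m n) fun x => ?_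
    rw [signAvg_neg]
    exact neg_le_neg (le_ciInf fun h => signAvg_queryValue_le x a m n (labels f x) h)
  have h3 : ∫ x, leastLoss H x (labels f x) 0 a ∂(infinitePi fun _ : ℕ => μ) +
      ∫ x, leastLoss H x (labels f x) a (m + 1) ∂(infinitePi fun _ : ℕ => μ) ≤
      ∫ x, leastLoss H x (labels f x) 0 (a + (m + 1)) ∂(infinitePi fun _ : ℕ => μ) := by
    rw [← integral_add (i0 _ _) (i0 _ _)]
    exact integral_mono ((i0 _ _).add (i0 _ _)) (i0 _ _) fun x => leastLoss_add_le hH x _ a (m + 1)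
  rw [integral_neg] at h2
  rw [totalRegret, totalRegret, Finset.sum_range_add]
  linarith

lemma totalRegret_le (hf : ∀ t, Measurable (f t)) (hH : H.Nonempty)
    (hM : MeasurableERM H) (μ : Measure X) [IsProbabilityMeasure μ] {T : ℕ} (hT : 1 ≤ T) :
    totalRegret H f (infinitePi fun _ : ℕ => μ) T ≤
      ∑ i ∈ Finset.range (Nat.log 2 T + 1), rademacher H (2 ^ i) := by
  have hstart : ∀ k m, m ≤ 2 ^ k - 1 → epochStart (2 ^ k - 1 + m) = 2 ^ k - 1 := by
    intro k m hm
    have := Nat.one_le_two_pow (n := k)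
    rw [epochStart, Nat.log_eq_of_pow_le_of_lt_pow (m := k) (by omega)
      (by rw [pow_succ]; omega)]
  have hstep : ∀ k m, m ≤ 2 ^ k - 1 →
      totalRegret H f (infinitePi fun _ : ℕ => μ) (2 ^ k - 1 + (m + 1)) ≤
        totalRegret H f (infinitePi fun _ : ℕ => μ) (2 ^ k - 1) + rademacher H (2 ^ k) := by
    intro k m hm
    have h := totalRegret_epoch_le hf hH hM μ (hstart k) hm
    rwa [Nat.sub_add_cancel Nat.one_le_two_pow] at h
  have hfull : ∀ k, totalRegret H f (infinitePi fun _ : ℕ => μ) (2 ^ k - 1) ≤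
      ∑ i ∈ Finset.range k, rademacher H (2 ^ i) := by
    intro k
    induction k with
    | zero => simp [totalRegret, leastLoss]
    | succ k ih =>
      have h := hstep k (2 ^ k - 1) le_rfl
      have e : 2 ^ k - 1 + (2 ^ k - 1 + 1) = 2 ^ (k + 1) - 1 := by
        have := Nat.one_le_two_pow (n := k)
        rw [pow_succ]
        omega
      rw [e] at h
      rw [Finset.sum_range_succ]
      linarith
  have h1 := Nat.pow_log_le_self 2 (x := T) (by omega)
  have h2 := Nat.lt_pow_succ_log_self (b := 2) (by norm_num) T
  have h3 := Nat.one_le_two_pow (n := Nat.log 2 T)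
  rw [pow_succ] at h2
  -- The horizon lies in the epoch with exponent `log₂ T`, of which `T - 2 ^ log₂ T + 1` rounds are
  -- played.
  have h4 := hstep (Nat.log 2 T) (T - 2 ^ Nat.log 2 T) (by omega)
  have e : 2 ^ Nat.log 2 T - 1 + (T - 2 ^ Nat.log 2 T + 1) = T := by omega
  rw [e] at h4
  rw [Finset.sum_range_succ]
  linarith [hfull (Nat.log 2 T)]

end Total

/-! ### From finitely many rounds to infinite feature sequences. -/

section ConditionalRegret

variable {X : Type u} {H : Set (X → I)}

/-- The extension of finitely many labelling functions by `0`. -/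
def extendLabelling {T : ℕ} (f : Fin T → X → I) (t : ℕ) : X → I :=
  if h : t < T then f ⟨t, h⟩ else fun _ => 0

instance isProbabilityMeasure_predictionLaw {Φ : PredictionRule X} {T : ℕ} {f : Fin T → X → I}
    {x : Fin T → X} (t : Fin T) : IsProbabilityMeasure (predictionLaw Φ f x t) := by
  unfold predictionLaw
  infer_instance

lemma integral_pi_eval_predictionLaw {Φ : PredictionRule X} {T : ℕ} {f : Fin T → X → I}
    {x : Fin T → X} (t : Fin T) {g : I → ℝ} (hg : Continuous g) :
    ∫ v : Fin T → I, g (v t) ∂(Measure.pi (predictionLaw Φ f x)) =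
      ∫ v, g v ∂(predictionLaw Φ f x t) :=
  integral_comp_eval hg.aestronglyMeasurable

lemma conditionalRegret_eq {T : ℕ} (f : Fin T → X → I) (x : ℕ → X) :
    conditionalRegret H (Playout.program.rule H) f (fun t => x t) =
      (∑ t ∈ Finset.range T, roundLoss H x (labels (extendLabelling f) x) t) -
        leastLoss H x (labels (extendLabelling f) x) 0 T := by
  have hf : f = fun t : Fin T => extendLabelling f t := by
    funext t
    simp [extendLabelling]
  have hint : ∀ t : Fin T, Integrable (fun v : Fin T → I => |(v t : ℝ) - f t (x t)|)
      (Measure.pi (predictionLaw (Playout.program.rule H) f fun t => x t)) := fun t => by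
    have hm : Measurable fun v : Fin T → I => |(v t : ℝ) - f t (x t)| :=
      (measurable_subtype_coe.comp (measurable_pi_apply t)).sub_const _ |>.abs
    refine Integrable.of_bound hm.aestronglyMeasurable 1 (ae_of_all _ fun v => ?_)
    rw [Real.norm_eq_abs, abs_abs]
    exact abs_sub_le_one _ _
  rw [conditionalRegret, integral_sub (integrable_finsetSum _ fun t _ => hint t)
    (integrable_const _), integral_finsetSum _ fun t _ => hint t]
  congr 1
  · rw [← Fin.sum_univ_eq_sum_range]
    refine Finset.sum_congr rfl fun t _ => ?_
    rw [integral_pi_eval_predictionLaw t (g := fun v => |(v : ℝ) - f t (x t)|) (by fun_prop),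
      roundLoss, labels, ← congrFun hf t]
    congr 1
    rw [predictionLaw]
    congr 2
    funext s
    exact congrFun (congrFun hf _) _
  · rw [integral_const, leastLoss]
    simp only [probReal_univ, one_smul, zero_add, labels]
    congr 1
    funext h
    refine Finset.sum_congr rfl fun t _ => ?_
    rw [congrFun hf t]

lemma abs_conditionalRegret_le (hH : H.Nonempty) {T : ℕ} (f : Fin T → X → I) (x : Fin T → X) :
    |conditionalRegret H (Playout.program.rule H) f x| ≤ T + T := by
  rw [conditionalRegret, ← Real.norm_eq_abs]
  refine (norm_integral_le_of_norm_le_const (C := T + T)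
    (μ := Measure.pi (predictionLaw (Playout.program.rule H) f x)) (ae_of_all _ fun v => ?_)).trans
    (by rw [probReal_univ, mul_one])
  refine (norm_sub_le _ _).trans (add_le_add ?_ ?_)
  · rw [Real.norm_eq_abs, abs_of_nonneg (Finset.sum_nonneg fun _ _ => abs_nonneg _)]
    exact (Finset.sum_le_card_nsmul _ _ 1 fun t _ => abs_sub_le_one _ _).trans (by simp)
  · have h := abs_mixedERM_le x (fun t => f t (x t)) 1 (Fin.elim0 : Fin 0 → Bool)
      (Fin.elim0 : Fin 0 → X) hH
    simpa [mixedERM] using h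

end ConditionalRegret

/-! ### Existence of the expectations and the bound on the oblivious regret. -/

section Oblivious

variable {X : Type u} [MeasurableSpace X] {H : Set (X → I)}

open Measure

lemma measurable_extendLabelling {T : ℕ} {f : Fin T → X → I} (hf : ∀ t, Measurable (f t))
    (t : ℕ) : Measurable (extendLabelling f t) := by
  unfold extendLabelling
  split_ifs with h
  · exact hf _
  · exact measurable_const

/-- A finite sequence is padded with a fixed point to an infinite one, measurably; the formula for
infinite sequences then applies. -/
lemma measurable_conditionalRegret (hH : H.Nonempty) (hM : MeasurableERM H) [Nonempty X] {T : ℕ}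
    {f : Fin T → X → I} (hf : ∀ t, Measurable (f t)) :
    Measurable (conditionalRegret H (Playout.program.rule H) f) := by
  obtain ⟨x₀⟩ := ‹Nonempty X›
  set e : (Fin T → X) → ℕ → X := fun x t => if h : t < T then x ⟨t, h⟩ else x₀ with he
  have hme : Measurable e := measurable_pi_lambda _ fun t => by
    by_cases h : t < T
    · simpa [he, h] using measurable_pi_apply _
    · simp [he, h]
  have hx : ∀ x, (fun t : Fin T => e x t) = x := fun x => by
    funext t
    simp [he]
  have hf' := measurable_extendLabelling hf
  have : conditionalRegret H (Playout.program.rule H) f = fun x =>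
      (∑ t ∈ Finset.range T, roundLoss H (e x) (labels (extendLabelling f) (e x)) t) -
        leastLoss H (e x) (labels (extendLabelling f) (e x)) 0 T := by
    funext x
    rw [← conditionalRegret_eq, hx]
  rw [this]
  exact (Finset.measurable_sum _ fun t _ => (measurable_roundLoss hf' hH hM t).comp hme).sub
    ((measurable_leastLoss hf' hH hM 0 T).comp hme)

lemma regretExists_program (hH : H.Nonempty) (hM : MeasurableERM H) :
    RegretExists H (Playout.program.rule H) := by
  intro T f hf μ
  have : Nonempty X := nonempty_of_isProbabilityMeasure (μ : Measure X)
  exact Integrable.of_bound (measurable_conditionalRegret hH hM hf).aestronglyMeasurable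
    (T + T) (ae_of_all _ fun x => abs_conditionalRegret_le hH f x)

lemma obliviousRegret_program_le (hH : H.Nonempty) (hM : MeasurableERM H) {T : ℕ} (hT : 1 ≤ T) :
    obliviousRegret H (Playout.program.rule H) T ≤
      ((∑ i ∈ Finset.range (Nat.log 2 T + 1), rademacher H (2 ^ i) : ℝ) : EReal) := by
  refine iSup_le fun f => iSup_le fun hf => iSup_le fun μ => EReal.coe_le_coe_iff.2 ?_
  have hf' := measurable_extendLabelling hf
  refine le_trans (le_of_eq ?_) (totalRegret_le hf' hH hM (μ : Measure X) hT)
  have hmp := measurePreserving_comp_infinitePi (μ : Measure X) (Fin.val_injective (n := T))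
  rw [infinitePi_eq_pi (ι := Fin T)] at hmp
  have h1 := (regretExists_program hH hM T f hf μ).aestronglyMeasurable
  rw [expectedRegret, ← hmp.map_eq, integral_map hmp.measurable.aemeasurable
    (by rwa [hmp.map_eq])]
  have i1 := integrable_roundLoss hf' hH hM (infinitePi fun _ : ℕ => (μ : Measure X))
  simp only [conditionalRegret_eq]
  rw [integral_sub (integrable_finsetSum _ fun t _ => i1 t)
    (integrable_leastLoss hf' hH hM _ 0 T), integral_finsetSum _ fun t _ => i1 t, totalRegret]

end Oblivious

/-! ### Maximal inequalities and chaining -/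

section Chaining

variable {T : ℕ}

lemma signAvg_exp_sum (w : Fin T → ℝ) :
    signAvg T (fun ε => Real.exp (∑ t, sgn (ε t) * w t)) = ∏ t, Real.cosh (w t) := by
  have h := Finset.prod_univ_sum (fun _ : Fin T => (Finset.univ : Finset Bool))
    fun t b => Real.exp (sgn b * w t)
  rw [Fintype.piFinset_univ] at h
  simp only [signAvg, Real.exp_sum]
  rw [← h]
  simp only [Fintype.sum_bool, sgn, if_true, Bool.false_eq_true, if_false, one_mul, neg_mul,
    Real.cosh_eq, Finset.prod_div_distrib, Finset.prod_const, Finset.card_univ, Fintype.card_fin]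

/-- The choice `c = a / r ^ 2` gives `(a / r) ^ 2 ≤ 2 * L`; it avoids dividing by `L`, which
vanishes for a one-point family. -/
lemma le_mul_sqrt_of_forall {a L r : ℝ} (hL : 0 ≤ L) (hr : 0 ≤ r)
    (h : ∀ c : ℝ, 0 < c → c * a ≤ L + c ^ 2 * r ^ 2 / 2) : a ≤ r * √(2 * L) := by
  rcases le_or_gt a 0 with ha | ha
  · exact ha.trans (by positivity)
  rcases hr.eq_or_lt with rfl | hr
  · have := h ((L + 1) / a) (by positivity)
    rw [div_mul_cancel₀ _ ha.ne'] at this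
    norm_num at this
  · have h1 := h (a / r ^ 2) (by positivity)
    have h2 : a / r ^ 2 * a = (a / r) ^ 2 := by field_simp
    have h3 : (a / r ^ 2) ^ 2 * r ^ 2 / 2 = (a / r) ^ 2 / 2 := by field_simp
    rw [h2, h3] at h1
    have h4 : a / r ≤ √(2 * L) := Real.le_sqrt_of_sq_le (by linarith)
    rwa [div_le_iff₀' hr] at h4

/-- The maximal inequality for finitely many Rademacher sums. -/
lemma signAvg_iSup_le_of_finite {ι : Type*} [Nonempty ι] (w : ι → Fin T → ℝ)
    (S : Finset (Fin T → ℝ)) (hS : ∀ i, w i ∈ S) {r : ℝ} (hr : 0 ≤ r)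
    (hw : ∀ i, ∑ t, w i t ^ 2 ≤ r ^ 2) :
    signAvg T (fun ε => ⨆ i, ∑ t, sgn (ε t) * w i t) ≤ r * √(2 * Real.log S.card) := by
  classical
  set S' := S.filter fun u => ∑ t, u t ^ 2 ≤ r ^ 2 with hS'
  have hmem : ∀ i, w i ∈ S' := fun i => Finset.mem_filter.2 ⟨hS i, hw i⟩
  have hne : S.Nonempty := ⟨_, hS (Classical.arbitrary ι)⟩
  have hcard : (1 : ℝ) ≤ S.card := by exact_mod_cast hne.card_pos
  refine le_mul_sqrt_of_forall (Real.log_nonneg hcard) hr fun c hc => ?_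
  set L := Real.log S.card + c ^ 2 * r ^ 2 / 2 with hL
  have hexp : ∀ u ∈ S', signAvg T (fun ε => Real.exp (∑ t, sgn (ε t) * (c * u t))) ≤
      Real.exp (c ^ 2 * r ^ 2 / 2) := by
    intro u hu
    rw [signAvg_exp_sum]
    refine (Finset.prod_le_prod (fun t _ => (Real.cosh_pos _).le)
      fun t _ => Real.cosh_le_exp_half_sq _).trans ?_
    rw [← Real.exp_sum, Real.exp_le_exp, ← Finset.sum_div]
    simp only [mul_pow, ← Finset.mul_sum]
    have := (Finset.mem_filter.1 hu).2
    gcongr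
  -- The tangent bound `z ≤ exp (z - L) + L - 1` replaces Jensen for the logarithm. `L` is chosen so
  -- that the averaged exponential term is at most `1`, leaving `L`.
  have hpt : ∀ ε : Fin T → Bool, c * (⨆ i, ∑ t, sgn (ε t) * w i t) ≤
      Real.exp (-L) * (∑ u ∈ S', Real.exp (∑ t, sgn (ε t) * (c * u t))) + (L - 1) := by
    intro ε
    rw [mul_comm, ← le_div_iff₀ hc]
    refine ciSup_le fun i => ?_
    rw [le_div_iff₀ hc, mul_comm, Finset.mul_sum]
    have h1 := Real.add_one_le_exp (∑ t, sgn (ε t) * (c * w i t) - L)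
    have h2 : Real.exp (∑ t, sgn (ε t) * (c * w i t)) ≤
        ∑ u ∈ S', Real.exp (∑ t, sgn (ε t) * (c * u t)) :=
      Finset.single_le_sum (f := fun u : Fin T → ℝ => Real.exp (∑ t, sgn (ε t) * (c * u t)))
        (fun _ _ => (Real.exp_pos _).le) (hmem i)
    rw [sub_eq_neg_add, Real.exp_add] at h1
    have h3 := mul_le_mul_of_nonneg_left h2 (Real.exp_pos (-L)).le
    have h4 : ∑ t, c * (sgn (ε t) * w i t) = ∑ t, sgn (ε t) * (c * w i t) :=
      Finset.sum_congr rfl fun t _ => by ring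
    rw [h4]
    linarith
  have h1 := signAvg_mono hpt
  have e1 : signAvg T (fun ε => c * (⨆ i, ∑ t, sgn (ε t) * w i t)) =
      c * signAvg T (fun ε => ⨆ i, ∑ t, sgn (ε t) * w i t) := by
    simp only [signAvg, ← Finset.mul_sum]
    ring
  have e2 : signAvg T (fun ε => Real.exp (-L) *
      (∑ u ∈ S', Real.exp (∑ t, sgn (ε t) * (c * u t))) + (L - 1)) =
      Real.exp (-L) * (∑ u ∈ S', signAvg T (fun ε => Real.exp (∑ t, sgn (ε t) * (c * u t)))) +
        (L - 1) := by
    rw [signAvg_add, signAvg_const]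
    congr 1
    simp only [signAvg, ← Finset.mul_sum, ← Finset.sum_div]
    rw [Finset.sum_comm]
    ring
  rw [e1, e2] at h1
  have h2 : ∑ u ∈ S', signAvg T (fun ε => Real.exp (∑ t, sgn (ε t) * (c * u t))) ≤
      Real.exp L := by
    refine (Finset.sum_le_card_nsmul _ _ _ hexp).trans ?_
    rw [nsmul_eq_mul, hL, Real.exp_add, Real.exp_log (by linarith)]
    gcongr
    exact Finset.filter_subset _ _
  have h3 := mul_le_mul_of_nonneg_left h2 (Real.exp_pos (-L)).le
  rw [← Real.exp_add, neg_add_cancel, Real.exp_zero] at h3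
  linarith

lemma bddAbove_sum_sgn_mul {ι : Type*} {w : ι → Fin T → ℝ} {B : ℝ} (hw : ∀ i t, |w i t| ≤ B)
    (ε : Fin T → Bool) : BddAbove (Set.range fun i => ∑ t, sgn (ε t) * w i t) := by
  refine ⟨∑ _t : Fin T, B, ?_⟩
  rintro _ ⟨i, rfl⟩
  refine Finset.sum_le_sum fun t _ => (le_abs_self _).trans ?_
  rw [abs_mul, abs_sgn, one_mul]
  exact hw i t

lemma signAvg_iSup_add_le {ι : Type*} [Nonempty ι] {v w : ι → Fin T → ℝ} {B : ℝ}
    (hv : ∀ i t, |v i t| ≤ B) (hw : ∀ i t, |w i t| ≤ B) :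
    signAvg T (fun ε => ⨆ i, ∑ t, sgn (ε t) * w i t) ≤
      signAvg T (fun ε => ⨆ i, ∑ t, sgn (ε t) * v i t) +
        signAvg T (fun ε => ⨆ i, ∑ t, sgn (ε t) * (w i t - v i t)) := by
  rw [← signAvg_add]
  refine signAvg_mono fun ε => ciSup_le fun i => ?_
  have h1 := le_ciSup (bddAbove_sum_sgn_mul hv ε) i
  have h2 := le_ciSup (bddAbove_sum_sgn_mul (w := fun i t => w i t - v i t) (B := B + B)
    (fun i t => (abs_sub _ _).trans (add_le_add (hw i t) (hv i t))) ε) i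
  refine le_trans (le_of_eq ?_) (add_le_add h1 h2)
  rw [← Finset.sum_add_distrib]
  exact Finset.sum_congr rfl fun t _ => by ring

lemma signAvg_iSup_const {ι : Type*} [Nonempty ι] (u : Fin T → ℝ) :
    signAvg T (fun ε => ⨆ _ : ι, ∑ t, sgn (ε t) * u t) = 0 := by
  simp only [ciSup_const]
  exact signAvg_sum_sgn_mul u

/-- The `ℓ²` triangle inequality through `a`, in squared form. -/
lemma sum_sub_sq_le {a b c : Fin T → ℝ} {r s : ℝ} (hr : 0 ≤ r) (hs : 0 ≤ s)
    (h1 : ∑ t, (a t - b t) ^ 2 ≤ r ^ 2) (h2 : ∑ t, (a t - c t) ^ 2 ≤ s ^ 2) :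
    ∑ t, (c t - b t) ^ 2 ≤ (r + s) ^ 2 := by
  have hcs := Finset.sum_mul_sq_le_sq_mul_sq Finset.univ (fun t => a t - b t)
    (fun t => c t - a t)
  have h2' : ∑ t, (c t - a t) ^ 2 ≤ s ^ 2 := by
    refine le_trans (le_of_eq ?_) h2
    exact Finset.sum_congr rfl fun t _ => by ring
  have h3 : (∑ t, (a t - b t) * (c t - a t)) ^ 2 ≤ (r * s) ^ 2 := by
    rw [mul_pow]
    exact hcs.trans (mul_le_mul h1 h2' (Finset.sum_nonneg fun _ _ => sq_nonneg _) (sq_nonneg _))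
  have h4 : ∑ t, (a t - b t) * (c t - a t) ≤ r * s := abs_le_of_sq_le_sq' h3 (by positivity) |>.2
  have e : ∑ t, (c t - b t) ^ 2 = ∑ t, (a t - b t) ^ 2 + ∑ t, (c t - a t) ^ 2 +
      2 * ∑ t, (a t - b t) * (c t - a t) := by
    rw [Finset.mul_sum, ← Finset.sum_add_distrib, ← Finset.sum_add_distrib]
    exact Finset.sum_congr rfl fun t _ => by ring
  rw [e]
  nlinarith

/-- Chaining: a class with coverings of radius `r j` and log-cardinality `ℓ j`. -/
lemma signAvg_iSup_le_chaining {ι : Type*} [Nonempty ι] (v : ι → Fin T → ℝ)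
    (hv : ∀ i t, |v i t| ≤ 1) {r ℓ : ℕ → ℝ} (hr : Antitone r) (hr0 : ∀ j, 0 ≤ r j)
    (hℓ : Monotone ℓ) (hdiam : ∀ i i', ∑ t, (v i t - v i' t) ^ 2 ≤ r 0 ^ 2) (J : ℕ)
    (hcover : ∀ j ≤ J, ∃ (S : Finset ι) (p : ι → ι), Real.log S.card ≤ ℓ j ∧
      ∀ i, p i ∈ S ∧ ∑ t, (v i t - v (p i) t) ^ 2 ≤ r j ^ 2) :
    signAvg T (fun ε => ⨆ i, ∑ t, sgn (ε t) * v i t) ≤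
      ∑ j ∈ Finset.range J, 4 * r j * √(ℓ (j + 1)) + √T * r J := by
  classical
  have hone : ∀ S : Finset ι, 0 ≤ Real.log S.card := fun S => Real.log_natCast_nonneg _
  have key : ∀ j ≤ J, ∃ (S : Finset ι) (p : ι → ι), Real.log S.card ≤ ℓ j ∧
      (∀ i, p i ∈ S ∧ ∑ t, (v i t - v (p i) t) ^ 2 ≤ r j ^ 2) ∧
      signAvg T (fun ε => ⨆ i, ∑ t, sgn (ε t) * v (p i) t) ≤
        ∑ j ∈ Finset.range j, 4 * r j * √(ℓ (j + 1)) := by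
    intro j
    induction j with
    | zero =>
      intro h
      obtain ⟨S, p, h1, -⟩ := hcover 0 h
      -- At scale `0` a single centre suffices because `r 0` bounds the diameter, and its Rademacher
      -- average is zero.
      refine ⟨{Classical.arbitrary ι}, fun _ => Classical.arbitrary ι, ?_, fun i => ⟨by simp,
        hdiam _ _⟩, ?_⟩
      · simpa using (hone S).trans h1
      · rw [signAvg_iSup_const]
        simp
    | succ j ih =>
      intro h
      obtain ⟨S, p, h1, h2, h3⟩ := ih (by omega)
      obtain ⟨S', p', h1', h2'⟩ := hcover (j + 1) h
      refine ⟨S', p', h1', h2', ?_⟩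
      refine (signAvg_iSup_add_le (v := fun i t => v (p i) t) (w := fun i t => v (p' i) t)
        (B := 1) (fun i t => hv _ t) (fun i t => hv _ t)).trans ?_
      rw [Finset.sum_range_succ]
      refine add_le_add h3 ?_
      refine (signAvg_iSup_le_of_finite (fun i t => v (p' i) t - v (p i) t)
        (Finset.image₂ (fun a b t => v a t - v b t) S' S)
        (fun i => Finset.mem_image₂_of_mem (f := fun a b t => v a t - v b t) (h2' i).1 (h2 i).1)
        (add_nonneg (hr0 j) (hr0 (j + 1))) fun i =>
          sum_sub_sq_le (hr0 j) (hr0 (j + 1)) (h2 i).2 (h2' i).2).trans ?_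
      have hne : S.Nonempty := ⟨_, (h2 (Classical.arbitrary ι)).1⟩
      have hne' : S'.Nonempty := ⟨_, (h2' (Classical.arbitrary ι)).1⟩
      have hc1 : (0 : ℝ) < S.card := by exact_mod_cast hne.card_pos
      have hc2 : (0 : ℝ) < S'.card := by exact_mod_cast hne'.card_pos
      -- The links from scale `j` to `j + 1` have length at most `2 * r j` and log-cardinality at
      -- most `ℓ j + ℓ (j + 1) ≤ 2 * ℓ (j + 1)`; together these give the factor `4`.
      have hlog : Real.log (Finset.image₂ (fun a b t => v a t - v b t) S' S).card ≤
          2 * ℓ (j + 1) := by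
        have hle : ((Finset.image₂ (fun a b t => v a t - v b t) S' S).card : ℝ) ≤
            S'.card * S.card := by
          exact_mod_cast Finset.card_image₂_le _ _ _
        have hpos : (0 : ℝ) < (Finset.image₂ (fun a b t => v a t - v b t) S' S).card := by
          exact_mod_cast (Finset.Nonempty.image₂ hne' hne).card_pos
        refine (Real.log_le_log hpos hle).trans ?_
        rw [Real.log_mul hc2.ne' hc1.ne']
        linarith [hℓ (Nat.le_succ j)]
      have hrr : r j + r (j + 1) ≤ 2 * r j := by linarith [hr (Nat.le_succ j)]
      have hsq : √(2 * Real.log (Finset.image₂ (fun a b t => v a t - v b t) S' S).card) ≤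
          2 * √(ℓ (j + 1)) := by
        have h4 : √(4 * ℓ (j + 1)) = 2 * √(ℓ (j + 1)) := by
          rw [Real.sqrt_mul (by norm_num), show (4 : ℝ) = 2 ^ 2 by norm_num,
            Real.sqrt_sq (by norm_num)]
        rw [← h4]
        exact Real.sqrt_le_sqrt (by linarith)
      refine (mul_le_mul hrr hsq (Real.sqrt_nonneg _) (by linarith [hr0 j])).trans (le_of_eq ?_)
      ring
  obtain ⟨S, p, -, h2, h3⟩ := key J le_rfl
  refine (signAvg_iSup_add_le (v := fun i t => v (p i) t) (fun i t => hv (p i) t) hv).trans ?_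
  refine add_le_add h3 ?_
  refine (signAvg_mono fun ε => ciSup_le fun i => ?_).trans (signAvg_const _).le
  -- The residual below the finest scale is bounded by Cauchy–Schwarz, the sign vector having norm
  -- `√T`.
  have hcs := Finset.sum_mul_sq_le_sq_mul_sq Finset.univ (fun t => sgn (ε t))
    (fun t => v i t - v (p i) t)
  refine (abs_le_of_sq_le_sq' (hcs.trans ?_) (mul_nonneg (Real.sqrt_nonneg _) (hr0 J))).2
  rw [mul_pow, Real.sq_sqrt (Nat.cast_nonneg _)]
  have : ∀ t, sgn (ε t) ^ 2 = 1 := fun t => by rw [← sq_abs, abs_sgn, one_pow]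
  simp only [this, Finset.sum_const, Finset.card_univ, Fintype.card_fin, nsmul_eq_mul, mul_one]
  exact mul_le_mul_of_nonneg_left (h2 i).2 (Nat.cast_nonneg _)

/-- A maximal packing is a covering. -/
lemma exists_cover_of_packing {ι : Type*} (far : ι → ι → Prop) (hirr : ∀ i, ¬ far i i)
    (hsymm : ∀ i j, far i j → far j i) {B : ℝ}
    (h : ∀ S : Finset ι, (S : Set ι).Pairwise far → (S.card : ℝ) ≤ B) :
    ∃ (S : Finset ι) (p : ι → ι), (S : Set ι).Pairwise far ∧ ∀ i, p i ∈ S ∧ ¬ far i (p i) := by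
  classical
  have hex : ∃ n, ∃ S : Finset ι, (S : Set ι).Pairwise far ∧ S.card = n := ⟨0, ∅, by simp, rfl⟩
  have hbound : ∀ n, (∃ S : Finset ι, (S : Set ι).Pairwise far ∧ S.card = n) → n ≤ ⌊B⌋₊ := by
    rintro n ⟨S, hS, rfl⟩
    exact Nat.le_floor (h S hS)
  obtain ⟨S, hS, hcard⟩ := Nat.findGreatest_spec (P := fun n => ∃ S : Finset ι,
    (S : Set ι).Pairwise far ∧ S.card = n) (Nat.zero_le ⌊B⌋₊) ⟨∅, by simp, rfl⟩
  have hmax : ∀ i, ∃ s ∈ S, ¬ far i s := by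
    intro i
    by_contra! hi
    have hiS : i ∉ S := fun hmem => hirr i (hi i hmem)
    have hins : ((insert i S : Finset ι) : Set ι).Pairwise far := by
      rw [Finset.coe_insert]
      exact hS.insert fun s hs _ => ⟨hi s hs, hsymm _ _ (hi s hs)⟩
    have h1 := Nat.le_findGreatest (P := fun n => ∃ S : Finset ι,
      (S : Set ι).Pairwise far ∧ S.card = n) (hbound _ ⟨_, hins, rfl⟩) ⟨_, hins, rfl⟩
    rw [Finset.card_insert_of_notMem hiS] at h1
    omega
  choose p hp hp' using hmax
  exact ⟨S, p, hS, fun i => ⟨hp i, hp' i⟩⟩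

end Chaining

/-! ### Classes of finite VC dimension -/

section VC

/-- Weighting each set by `c ^ card` and using the binomial theorem bounds the number of small sets
without estimating binomial coefficients. The parameter `c` is tuned at each use. -/
lemma card_mul_pow_le {α : Type*} (Ω : Finset α) (𝒮 : Finset (Finset α)) {d : ℕ} {c : ℝ}
    (h𝒮 : ∀ s ∈ 𝒮, s ⊆ Ω ∧ s.card ≤ d) (hc : 0 ≤ c) (hc1 : c ≤ 1) :
    𝒮.card * c ^ d ≤ Real.exp (c * Ω.card) := by
  classical
  calc (𝒮.card : ℝ) * c ^ d = ∑ _s ∈ 𝒮, c ^ d := by simp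
    _ ≤ ∑ s ∈ 𝒮, c ^ s.card :=
      Finset.sum_le_sum fun s hs => pow_le_pow_of_le_one hc hc1 (h𝒮 s hs).2
    _ ≤ ∑ s ∈ Ω.powerset, c ^ s.card :=
      Finset.sum_le_sum_of_subset_of_nonneg (fun s hs => Finset.mem_powerset.2 (h𝒮 s hs).1)
        fun _ _ _ => by positivity
    _ = (c + 1) ^ Ω.card := by
      rw [← Finset.sum_pow_mul_eq_add_pow]
      simp
    _ ≤ Real.exp c ^ Ω.card := by
      gcongr
      exact Real.add_one_le_exp c
    _ = Real.exp (c * Ω.card) := by rw [← Real.exp_nat_mul, mul_comm]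

variable {X : Type u} {H : Set (X → I)}

lemma card_le_of_shatters {d : ℕ} (hd : vcDim H ≤ d) {S : Finset X} (hS : Shatters H S) :
    S.card ≤ d := by
  have h : (S.card : ℕ∞) ≤ vcDim H := le_iSup₂_of_le S hS le_rfl
  exact_mod_cast h.trans hd

/-- The trace of a binary expert on the points `x`. -/
def trace {m : ℕ} (x : Fin m → X) (h : X → I) : Finset (Fin m) :=
  Finset.univ.filter fun k => h (x k) = 1

/-- Sample points may repeat, but two indices of the same point cannot both lie in a shattered set;
so a shattered index set maps injectively to a shattered set of points. -/
lemma card_le_of_trace_shatters {d : ℕ} (hd : vcDim H ≤ d) {m : ℕ} (x : Fin m → X)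
    (S : Finset H) {K : Finset (Fin m)}
    (hK : (S.image fun h => trace x h.1).Shatters K) : K.card ≤ d := by
  classical
  have hK' : ∀ E ⊆ K, ∃ h : H, ∀ k ∈ K, h.1 (x k) = 1 ↔ k ∈ E := by
    intro E hE
    obtain ⟨u, hu, hKu⟩ := hK hE
    obtain ⟨h, -, rfl⟩ := Finset.mem_image.1 hu
    refine ⟨h, fun k hk => ?_⟩
    rw [← hKu]
    simp [trace, hk]
  have hinj : Set.InjOn x K := by
    intro k hk k' hk' hkk
    obtain ⟨h, hh⟩ := hK' {k} (by simpa using hk)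
    have h1 := (hh k hk).2 (by simp)
    rw [hkk] at h1
    have h2 := (hh k' hk').1 h1
    exact (Finset.mem_singleton.1 h2).symm
  rw [← Finset.card_image_of_injOn hinj]
  refine card_le_of_shatters hd fun E hE => ?_
  obtain ⟨h, hh⟩ := hK' (K.filter fun k => x k ∈ E) (Finset.filter_subset _ _)
  refine ⟨h.1, h.2, fun z hz => ?_⟩
  obtain ⟨k, hk, rfl⟩ := Finset.mem_image.1 hz
  rw [hh k hk]
  simp [hk]

/-- The Sauer-Shelah lemma for a class of experts. -/
lemma card_mul_pow_le_of_trace_injOn {d : ℕ} (hd : vcDim H ≤ d) {m : ℕ} (x : Fin m → X)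
    (S : Finset H) (hS : Set.InjOn (fun h : H => trace x h.1) S) {c : ℝ} (hc : 0 ≤ c)
    (hc1 : c ≤ 1) : S.card * c ^ d ≤ Real.exp (c * m) := by
  classical
  rw [← Finset.card_image_of_injOn hS]
  have h1 := Finset.card_le_card_shatterer (S.image fun h : H => trace x h.1)
  have h2 := card_mul_pow_le (Ω := Finset.univ)
    (S.image fun h : H => trace x h.1).shatterer (d := d) (fun K hK => ⟨Finset.subset_univ _,
      card_le_of_trace_shatters hd x S (Finset.mem_shatterer.1 hK)⟩) hc hc1
  rw [Finset.card_univ, Fintype.card_fin] at h2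
  refine le_trans ?_ h2
  gcongr

/-- Few random coordinates separate a set of experts that are pairwise far apart. -/
lemma exists_trace_injOn {T : ℕ} (x : Fin T → X) (S : Finset H) (hne : S.Nonempty) (hT : 0 < T)
    {e : ℝ}
    (hfar : (S : Set H).Pairwise fun g h =>
      e * T ≤ (Finset.univ.filter fun t => g.1 (x t) = 1 ↔ ¬ h.1 (x t) = 1).card) {m : ℕ}
    (hm : 2 * Real.log S.card ≤ e * m) :
    ∃ s : Fin m → Fin T, Set.InjOn (fun h : H => trace (fun k => x (s k)) h.1) S := by
  classical
  -- Counting form of the probabilistic method: each pair agrees on all coordinates of at most an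
  -- `exp (-(e * m))` fraction of the samples, and there are fewer than `S.card ^ 2 ≤ exp (e * m)`
  -- ordered pairs.
  by_contra! hno
  have hbad : ∀ s : Fin m → Fin T, ∃ p ∈ S.offDiag,
      ∀ k, s k ∈ Finset.univ.filter fun t => (p.1.1 (x t) = 1 ↔ p.2.1 (x t) = 1) := by
    intro s
    have h1 := hno s
    simp only [Set.InjOn, not_forall] at h1
    obtain ⟨g, hg, h, hh, hgh, hne⟩ := h1
    refine ⟨(g, h), Finset.mem_offDiag.2 ⟨hg, hh, hne⟩, fun k => ?_⟩
    have := Finset.ext_iff.1 hgh k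
    simpa [trace] using this
  have hcover : (Finset.univ : Finset (Fin m → Fin T)) ⊆ S.offDiag.biUnion fun p =>
      Fintype.piFinset fun _ : Fin m =>
        Finset.univ.filter fun t => (p.1.1 (x t) = 1 ↔ p.2.1 (x t) = 1) := by
    intro s _
    obtain ⟨p, hp, hs⟩ := hbad s
    exact Finset.mem_biUnion.2 ⟨p, hp, Fintype.mem_piFinset.2 hs⟩
  have hcard := (Finset.card_le_card hcover).trans Finset.card_biUnion_le
  have hone : ∀ p ∈ S.offDiag, ((Fintype.piFinset fun _ : Fin m =>
      Finset.univ.filter fun t => (p.1.1 (x t) = 1 ↔ p.2.1 (x t) = 1)).card : ℝ) ≤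
      Real.exp (-(e * m)) * (T : ℝ) ^ m := by
    intro p hp
    obtain ⟨h1, h2, h3⟩ := Finset.mem_offDiag.1 hp
    have hf := hfar h1 h2 h3
    have hsum := Finset.card_filter_add_card_filter_not (s := (Finset.univ : Finset (Fin T)))
      (fun t => (p.1.1 (x t) = 1 ↔ p.2.1 (x t) = 1))
    have heq : (Finset.univ.filter fun t => ¬(p.1.1 (x t) = 1 ↔ p.2.1 (x t) = 1)) =
        Finset.univ.filter fun t => (p.1.1 (x t) = 1 ↔ ¬ p.2.1 (x t) = 1) := by
      ext t
      simp only [Finset.mem_filter, Finset.mem_univ, true_and]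
      tauto
    rw [heq, Finset.card_univ, Fintype.card_fin] at hsum
    have hsum' : ((Finset.univ.filter fun t => (p.1.1 (x t) = 1 ↔ p.2.1 (x t) = 1)).card : ℝ) +
        (Finset.univ.filter fun t => (p.1.1 (x t) = 1 ↔ ¬ p.2.1 (x t) = 1)).card = T := by
      exact_mod_cast hsum
    rw [Fintype.card_piFinset_const, Nat.cast_pow]
    calc ((Finset.univ.filter fun t => (p.1.1 (x t) = 1 ↔ p.2.1 (x t) = 1)).card : ℝ) ^ m
        ≤ (Real.exp (-e) * T) ^ m := by
          gcongr
          have := Real.add_one_le_exp (-e)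
          have hT : (0 : ℝ) ≤ T := Nat.cast_nonneg _
          nlinarith
      _ = Real.exp (-(e * m)) * (T : ℝ) ^ m := by
          rw [mul_pow, ← Real.exp_nat_mul]
          congr 2
          ring
  have hcard' : ((T : ℝ)) ^ m ≤ S.offDiag.card * (Real.exp (-(e * m)) * (T : ℝ) ^ m) := by
    have h1 : (((Finset.univ : Finset (Fin m → Fin T)).card : ℕ) : ℝ) ≤
        ∑ p ∈ S.offDiag, ((Fintype.piFinset fun _ : Fin m =>
          Finset.univ.filter fun t => (p.1.1 (x t) = 1 ↔ p.2.1 (x t) = 1)).card : ℝ) := by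
      exact_mod_cast hcard
    rw [Finset.card_univ, Fintype.card_fun, Fintype.card_fin, Fintype.card_fin,
      Nat.cast_pow] at h1
    refine h1.trans ((Finset.sum_le_card_nsmul _ _ _ hone).trans (le_of_eq ?_))
    rw [nsmul_eq_mul]
  have hTm : (0 : ℝ) < (T : ℝ) ^ m := by positivity
  have hS1 : (1 : ℝ) ≤ S.card := by exact_mod_cast hne.card_pos
  have hoff : (S.offDiag.card : ℝ) < S.card * S.card := by
    rw [Finset.offDiag_card]
    have := hne.card_pos
    exact_mod_cast Nat.sub_lt (Nat.mul_pos this this) this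
  have hexp : Real.exp (-(e * m)) * (S.card * S.card) ≤ 1 := by
    have h1 : (S.card * S.card : ℝ) = Real.exp (2 * Real.log S.card) := by
      rw [two_mul, Real.exp_add, Real.exp_log (by linarith)]
    rw [h1, ← Real.exp_add, Real.exp_le_one_iff]
    linarith
  have h2 : (S.offDiag.card : ℝ) * Real.exp (-(e * m)) < 1 := by
    refine lt_of_lt_of_le ?_ hexp
    rw [mul_comm]
    exact mul_lt_mul_of_pos_left hoff (Real.exp_pos _)
  nlinarith

/-- The packing numbers of a class of finite VC dimension. -/
lemma log_card_le_of_pairwise_far {d : ℕ} (hd : vcDim H ≤ d) {T : ℕ} (hT : 0 < T)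
    (x : Fin T → X) (S : Finset H) (hne : S.Nonempty) {e : ℝ} (he0 : 0 < e) (he1 : e ≤ 1)
    (hfar : (S : Set H).Pairwise fun g h =>
      e * T ≤ (Finset.univ.filter fun t => g.1 (x t) = 1 ↔ ¬ h.1 (x t) = 1).card) :
    Real.log S.card ≤ 4 / 3 * (d * Real.log (8 / e) + 1 / 8) := by
  have hS1 : (1 : ℝ) ≤ S.card := by exact_mod_cast hne.card_pos
  have hL := Real.log_nonneg hS1
  set m := ⌈2 * Real.log S.card / e⌉₊ with hm
  have hm1 : 2 * Real.log S.card / e ≤ m := Nat.le_ceil _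
  have hm2 : (m : ℝ) < 2 * Real.log S.card / e + 1 := Nat.ceil_lt_add_one (by positivity)
  rw [div_le_iff₀' he0] at hm1
  obtain ⟨s, hs⟩ := exists_trace_injOn x S hne hT hfar hm1
  -- Since `m` is about `2 * log S.card / e`, the weight `e / 8` keeps the exponent below `log
  -- S.card / 4 + 1 / 8`. That quarter is absorbed on the left, hence the factor `4 / 3`.
  have h := card_mul_pow_le_of_trace_injOn hd (fun k => x (s k)) S hs (c := e / 8)
    (by positivity) (by linarith)
  have h' := Real.log_le_log (by positivity) h
  rw [Real.log_exp, Real.log_mul (by positivity) (by positivity), Real.log_pow] at h'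
  have h8 : Real.log (8 / e) = -Real.log (e / 8) := by
    rw [← Real.log_inv, inv_div]
  rw [h8]
  have h3 : e / 8 * m ≤ Real.log S.card / 4 + 1 / 8 := by
    have : e / 8 * (2 * Real.log S.card / e + 1) = Real.log S.card / 4 + e / 8 := by
      field_simp
      ring
    have h4 := mul_le_mul_of_nonneg_left hm2.le (by positivity : 0 ≤ e / 8)
    linarith
  linarith

lemma sum_sub_sq_eq_card (hb : IsBinary H) {T : ℕ} (x : Fin T → X) (g h : H) :
    ∑ t, ((g.1 (x t) : ℝ) - h.1 (x t)) ^ 2 =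
      (Finset.univ.filter fun t => g.1 (x t) = 1 ↔ ¬ h.1 (x t) = 1).card := by
  rw [Finset.card_filter, Nat.cast_sum]
  refine Finset.sum_congr rfl fun t _ => ?_
  rcases hb g.1 g.2 (x t) with e | e <;> rcases hb h.1 h.2 (x t) with e' | e' <;> simp [e, e']

lemma sum_add_three_mul_half_pow_le (J : ℕ) :
    ∑ j ∈ Finset.range J, ((j : ℝ) + 3) * (1 / 2) ^ j ≤ 8 := by
  have h : ∑ j ∈ Finset.range J, ((j : ℝ) + 3) * (1 / 2) ^ j =
      8 - 2 * ((J : ℝ) + 4) * (1 / 2) ^ J := by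
    induction J with
    | zero => norm_num
    | succ J ih =>
      rw [Finset.sum_range_succ, ih, pow_succ]
      push_cast
      ring
  rw [h]
  have : 0 ≤ 2 * ((J : ℝ) + 4) * (1 / 2) ^ J := by positivity
  linarith

lemma rademacher_le_of_forall {T : ℕ} {B : ℝ} (hB : 0 ≤ B)
    (h : ∀ x : Fin T → X,
      signAvg T (fun ε => ⨆ h : H, ∑ t, sgn (ε t) * (h.1 (x t) : ℝ)) ≤ B) :
    rademacher H T ≤ B :=
  Real.iSup_le h hB

/-- Two experts that differ at a point shatter it, so the class is a single function. This case is
separate because the entropy bound used for chaining absorbs an additive constant into `d ≥ 1`. -/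
lemma rademacher_le_zero_of_vcDim_eq_zero (hH : H.Nonempty) (hb : IsBinary H)
    (hd : vcDim H = 0) (T : ℕ) : rademacher H T ≤ 0 := by
  classical
  have := hH.to_subtype
  obtain ⟨h₀, hh₀⟩ := hH
  have hone : ∀ h ∈ H, ∀ x, h x = h₀ x := by
    intro h hh x
    by_contra hne
    have hS : Shatters H {x} := by
      intro E hE
      rcases Finset.subset_singleton_iff.1 hE with rfl | rfl
      · rcases hb h hh x with e | e
        · exact ⟨h, hh, by simp [e]⟩
        · exact ⟨h₀, hh₀, by
            have := (hb h₀ hh₀ x).resolve_right (by rw [← e]; exact Ne.symm hne)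
            simp [this]⟩
      · rcases hb h hh x with e | e
        · exact ⟨h₀, hh₀, by
            have := (hb h₀ hh₀ x).resolve_left (by rw [← e]; exact Ne.symm hne)
            simp [this]⟩
        · exact ⟨h, hh, by simp [e]⟩
    have := card_le_of_shatters (d := 0) (by simp [hd]) hS
    simp at this
  refine rademacher_le_of_forall le_rfl fun x => ?_
  have h1 : ∀ ε : Fin T → Bool, (⨆ h : H, ∑ t, sgn (ε t) * (h.1 (x t) : ℝ)) =
      ⨆ _ : H, ∑ t, sgn (ε t) * (h₀ (x t) : ℝ) := fun ε => by
    congr 1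
    funext h
    refine Finset.sum_congr rfl fun t _ => ?_
    rw [hone h.1 h.2]
  simp only [h1]
  exact (signAvg_iSup_const fun t => (h₀ (x t) : ℝ)).le

/-- The Rademacher complexity of a class of finite VC dimension. -/
lemma rademacher_le_of_vcDim (hH : H.Nonempty) (hb : IsBinary H) {d : ℕ} (hd : vcDim H = d)
    {T : ℕ} (hT : 1 ≤ T) : rademacher H T ≤ 33 * √((d : ℝ) * T) := by
  have := hH.to_subtype
  rcases Nat.eq_zero_or_pos d with rfl | hd1
  · simpa using rademacher_le_zero_of_vcDim_eq_zero hH hb (by simpa using hd) T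
  refine rademacher_le_of_forall (by positivity) fun x => ?_
  have hd1' : (1 : ℝ) ≤ d := by exact_mod_cast hd1
  have hT' : (1 : ℝ) ≤ T := by exact_mod_cast hT
  have hsq : ∀ j : ℕ, (√(T : ℝ) * (1 / 2) ^ j) ^ 2 = (1 / 4) ^ j * T := fun j => by
    rw [mul_pow, Real.sq_sqrt (by positivity), ← pow_mul, mul_comm j 2, pow_mul, mul_comm]
    norm_num
  -- Radius `√T * 2⁻ʲ` corresponds to a disagreement fraction `e = 4⁻ʲ`. The chaining sum
  -- contributes `4 * 8 * √(d * T)`, and after `T` scales the residual is at most `1`, giving `33`.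
  have hchain := signAvg_iSup_le_chaining (fun (h : H) t => (h.1 (x t) : ℝ))
    (fun h t => by rw [abs_of_nonneg (h.1 (x t)).2.1]; exact (h.1 (x t)).2.2)
    (r := fun j => √(T : ℝ) * (1 / 2) ^ j) (ℓ := fun j => 3 * d * ((j : ℝ) + 2))
    (fun i j hij => mul_le_mul_of_nonneg_left
      (pow_le_pow_of_le_one (by norm_num) (by norm_num) hij) (by positivity))
    (fun j => by positivity)
    (fun i j hij => by
      have : (i : ℝ) ≤ j := by exact_mod_cast hij
      dsimp only
      gcongr)
    (fun g h => by
      rw [hsq, sum_sub_sq_eq_card hb, pow_zero, one_mul]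
      exact_mod_cast (Finset.card_le_univ _).trans (by simp))
    T (fun j _ => ?_)
  · refine hchain.trans ?_
    have h1 : ∀ j ∈ Finset.range T, 4 * (√(T : ℝ) * (1 / 2) ^ j) *
        √(3 * d * (((j + 1 : ℕ) : ℝ) + 2)) ≤
        4 * √((d : ℝ) * T) * (((j : ℝ) + 3) * (1 / 2) ^ j) := by
      intro j _
      have h2 : √(3 * d * (((j + 1 : ℕ) : ℝ) + 2)) ≤ √(d : ℝ) * ((j : ℝ) + 3) := by
        rw [Real.sqrt_le_left (by positivity), mul_pow, Real.sq_sqrt (by positivity)]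
        push_cast
        have hj : (0 : ℝ) ≤ j := Nat.cast_nonneg j
        have : 3 * ((j : ℝ) + 3) ≤ ((j : ℝ) + 3) ^ 2 := by nlinarith
        nlinarith
      rw [Real.sqrt_mul (by positivity : (0 : ℝ) ≤ d) (T : ℝ)]
      calc 4 * (√(T : ℝ) * (1 / 2) ^ j) * √(3 * d * (((j + 1 : ℕ) : ℝ) + 2))
          ≤ 4 * (√(T : ℝ) * (1 / 2) ^ j) * (√(d : ℝ) * ((j : ℝ) + 3)) := by gcongr
        _ = _ := by ring
    have h3 := Finset.sum_le_sum h1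
    rw [← Finset.mul_sum] at h3
    have h4 := mul_le_mul_of_nonneg_left (sum_add_three_mul_half_pow_le T)
      (by positivity : 0 ≤ 4 * √((d : ℝ) * T))
    have h5 : √(T : ℝ) * (√(T : ℝ) * (1 / 2) ^ T) ≤ √((d : ℝ) * T) := by
      rw [← mul_assoc, Real.mul_self_sqrt (by positivity)]
      have h6 : (T : ℝ) * (1 / 2) ^ T ≤ 1 := by
        rw [one_div, inv_pow, ← div_eq_mul_inv, div_le_one (by positivity)]
        exact_mod_cast Nat.lt_two_pow_self.le
      refine h6.trans (Real.one_le_sqrt.2 ?_)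
      nlinarith
    linarith
  · have hpack : ∀ S : Finset H, (S : Set H).Pairwise (fun g h : H =>
        (√(T : ℝ) * (1 / 2) ^ j) ^ 2 < ∑ t, ((g.1 (x t) : ℝ) - h.1 (x t)) ^ 2) →
        Real.log S.card ≤ 3 * d * ((j : ℝ) + 2) := by
      intro S hS
      rcases S.eq_empty_or_nonempty with rfl | hne
      · simp only [Finset.card_empty, Nat.cast_zero, Real.log_zero]
        positivity
      have h1 := log_card_le_of_pairwise_far hd.le hT x S hne (e := (1 / 4) ^ j) (by positivity)
        (pow_le_one₀ (by norm_num) (by norm_num)) (fun g hg h hh hgh => by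
          have := hS hg hh hgh
          rw [hsq, sum_sub_sq_eq_card hb] at this
          exact this.le)
      have h2 : Real.log (8 / (1 / 4) ^ j) ≤ 2 * j + 3 := by
        have e : (8 : ℝ) / (1 / 4) ^ j = 2 ^ (2 * j + 3) := by
          rw [pow_add, pow_mul, one_div, inv_pow, div_inv_eq_mul, mul_comm]
          norm_num
        rw [e, Real.log_pow]
        have := Real.log_two_lt_d9
        push_cast
        nlinarith [(Nat.cast_nonneg j : (0 : ℝ) ≤ j)]
      have hj : (0 : ℝ) ≤ j := Nat.cast_nonneg j
      have h3 : (d : ℝ) * Real.log (8 / (1 / 4) ^ j) ≤ d * (2 * j + 3) := by gcongr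
      nlinarith
    obtain ⟨S, p, hS, hp⟩ := exists_cover_of_packing
      (fun g h : H => (√(T : ℝ) * (1 / 2) ^ j) ^ 2 <
        ∑ t, ((g.1 (x t) : ℝ) - h.1 (x t)) ^ 2)
      (fun h => by simp only [sub_self]; simpa using sq_nonneg _)
      (fun g h hgh => by
        refine hgh.trans_le (le_of_eq (Finset.sum_congr rfl fun t _ => ?_))
        ring) (B := Real.exp (3 * d * ((j : ℝ) + 2))) (fun S hS => by
        rcases S.eq_empty_or_nonempty with rfl | hne
        · simpa using (Real.exp_pos _).le
        · have : (0 : ℝ) < S.card := by exact_mod_cast hne.card_pos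
          rw [← Real.exp_log this]
          exact Real.exp_le_exp.2 (hpack S hS))
    exact ⟨S, p, hpack S hS, fun i => ⟨(hp i).1, not_lt.1 (hp i).2⟩⟩

end VC

/-! ### Fat-shattering and packing numbers -/

section Levels

variable {X : Type u}

/-- The points `x` with levels `s` in `P` are shattered by the integer-valued functions in `F`,
with a gap around the level. -/
def LevelShatters (F : Finset (X → ℕ)) (P : Finset (X × ℕ)) : Prop :=
  ∀ E ⊆ P, ∃ f ∈ F, ∀ p ∈ P, (p ∈ E → p.2 + 1 ≤ f p.1) ∧ (p ∉ E → f p.1 + 1 ≤ p.2)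

open scoped Classical in
/-- The sets of points in `D` with levels below `b` that are shattered by `F`. -/
def levelShatterer (F : Finset (X → ℕ)) (D : Finset X) (b : ℕ) : Finset (Finset (X × ℕ)) :=
  (D ×ˢ Finset.range b).powerset.filter (LevelShatters F)

lemma mem_levelShatterer {F : Finset (X → ℕ)} {D : Finset X} {b : ℕ} {P : Finset (X × ℕ)} :
    P ∈ levelShatterer F D b ↔ P ⊆ D ×ˢ Finset.range b ∧ LevelShatters F P := by
  simp [levelShatterer]

lemma LevelShatters.mono {F G : Finset (X → ℕ)} {P : Finset (X × ℕ)} (h : LevelShatters F P)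
    (hFG : F ⊆ G) : LevelShatters G P := fun E hE =>
  let ⟨f, hf, hfP⟩ := h E hE
  ⟨f, hFG hf, hfP⟩

/-- Every set shattered by either subfamily is shattered by `F`. A set shattered by both can also be
enlarged by `(x, i + 1)`, with `F₂` above this level at `x` and `F₁` below it. So sets in the
intersection are counted twice. -/
lemma card_levelShatterer_add_le {F F₁ F₂ : Finset (X → ℕ)} (h₁ : F₁ ⊆ F) (h₂ : F₂ ⊆ F)
    [DecidableEq X] {D : Finset X} {b : ℕ} {x : X} (hx : x ∈ D) {i j : ℕ} (hij : i + 2 ≤ j)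
    (hj : j < b) (hF₁ : ∀ f ∈ F₁, f x = i) (hF₂ : ∀ f ∈ F₂, f x = j) :
    (levelShatterer F₁ (D.erase x) b).card + (levelShatterer F₂ (D.erase x) b).card ≤
      (levelShatterer F D b).card := by
  classical
  set S₁ := levelShatterer F₁ (D.erase x) b
  set S₂ := levelShatterer F₂ (D.erase x) b
  have hnot : ∀ P, P ⊆ (D.erase x) ×ˢ Finset.range b → (x, i + 1) ∉ P := fun P hP hxP => by
    simpa using hP hxP
  have hsub : (D.erase x) ×ˢ Finset.range b ⊆ D ×ˢ Finset.range b :=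
    Finset.product_subset_product_left (Finset.erase_subset _ _)
  have hmem : ∀ P, P ∈ S₁ ∪ S₂ → P ⊆ (D.erase x) ×ˢ Finset.range b := fun P hP =>
    (Finset.mem_union.1 hP).elim (fun h => (mem_levelShatterer.1 h).1)
      fun h => (mem_levelShatterer.1 h).1
  have hinj : Set.InjOn (insert (x, i + 1)) ((S₁ ∩ S₂ : Finset (Finset (X × ℕ))) :
      Set (Finset (X × ℕ))) := by
    intro P hP Q hQ hPQ
    have hP' := hnot P (hmem P (Finset.mem_union_left _ (Finset.mem_inter.1 hP).1))
    have hQ' := hnot Q (hmem Q (Finset.mem_union_left _ (Finset.mem_inter.1 hQ).1))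
    rw [← Finset.erase_insert hP', ← Finset.erase_insert hQ', hPQ]
  have hdisj : Disjoint (S₁ ∪ S₂) ((S₁ ∩ S₂).image (insert (x, i + 1))) := by
    rw [Finset.disjoint_left]
    intro P hP hP'
    obtain ⟨Q, -, rfl⟩ := Finset.mem_image.1 hP'
    exact hnot _ (hmem _ hP) (Finset.mem_insert_self _ _)
  rw [← Finset.card_union_add_card_inter, ← Finset.card_image_of_injOn hinj,
    ← Finset.card_union_of_disjoint hdisj]
  refine Finset.card_le_card fun P hP => ?_
  rw [mem_levelShatterer]
  rcases Finset.mem_union.1 hP with hP | hP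
  · refine ⟨(hmem P hP).trans hsub, ?_⟩
    rcases Finset.mem_union.1 hP with h | h
    · exact (mem_levelShatterer.1 h).2.mono h₁
    · exact (mem_levelShatterer.1 h).2.mono h₂
  · obtain ⟨Q, hQ, rfl⟩ := Finset.mem_image.1 hP
    obtain ⟨hQ₁, hQ₂⟩ := Finset.mem_inter.1 hQ
    obtain ⟨hQD, hQ₁⟩ := mem_levelShatterer.1 hQ₁
    obtain ⟨-, hQ₂⟩ := mem_levelShatterer.1 hQ₂
    refine ⟨Finset.insert_subset (Finset.mem_product.2 ⟨hx, Finset.mem_range.2 (by omega)⟩)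
      (hQD.trans hsub), fun E hE => ?_⟩
    have hE' : E.erase (x, i + 1) ⊆ Q := Finset.subset_insert_iff.1 hE
    by_cases hxE : (x, i + 1) ∈ E
    · obtain ⟨f, hf, hfQ⟩ := hQ₂ _ hE'
      refine ⟨f, h₂ hf, fun p hp => ?_⟩
      rcases Finset.mem_insert.1 hp with rfl | hp
      · simp only [hxE, hF₂ f hf]
        exact ⟨fun _ => by omega, fun h => absurd trivial h⟩
      · have hne : p ≠ (x, i + 1) := fun h => hnot Q hQD (h ▸ hp)
        simpa [hne] using hfQ p hp
    · obtain ⟨f, hf, hfQ⟩ := hQ₁ _ hE'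
      refine ⟨f, h₁ hf, fun p hp => ?_⟩
      rcases Finset.mem_insert.1 hp with rfl | hp
      · simp only [hxE, hF₁ f hf]
        exact ⟨fun h => absurd h id, fun _ => by omega⟩
      · have hne : p ≠ (x, i + 1) := fun h => hnot Q hQD (h ▸ hp)
        simpa [hne] using hfQ p hp

/-- A large class of pairwise separated integer-valued functions shatters many sets. -/
lemma two_pow_le_card_levelShatterer {b n : ℕ} (hb : 1 ≤ b) (hn : 1 ≤ n) (r : ℕ)
    (F : Finset (X → ℕ)) (D : Finset X) (hD : D.card ≤ n) (hval : ∀ f ∈ F, ∀ x ∈ D, f x < b)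
    (hsep : (F : Set (X → ℕ)).Pairwise fun f g => ∃ x ∈ D, f x + 2 ≤ g x ∨ g x + 2 ≤ f x)
    (hcard : (2 * (n * (b * b))) ^ r ≤ F.card) : 2 ^ r ≤ (levelShatterer F D b).card := by
  classical
  induction r generalizing F D with
  | zero =>
    rw [pow_zero, Nat.one_le_iff_ne_zero, ← Nat.pos_iff_ne_zero, Finset.card_pos]
    rw [pow_zero] at hcard
    obtain ⟨f, hf⟩ := Finset.card_pos.1 hcard
    exact ⟨∅, mem_levelShatterer.2 ⟨Finset.empty_subset _, fun E _ => ⟨f, hf, by simp⟩⟩⟩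
  | succ r ih =>
    set c := 2 * (n * (b * b)) with hc
    -- `F` contains `m` disjoint pairs. By pigeonhole, `c ^ r` of them share their separating point
    -- `x` and both values there, as there are at most `n * b ^ 2` possibilities.
    set m := n * (b * b) * c ^ r with hm
    have hc1 : 1 ≤ c ^ r := Nat.one_le_pow _ _ (by positivity)
    have hm1 : 0 < m := by positivity
    have h2m : 2 * m ≤ F.card := by
      refine le_trans (le_of_eq ?_) hcard
      rw [hm, pow_succ, hc]
      ring
    set u : Fin m → F := fun k => F.equivFin.symm ⟨2 * k, by omega⟩ with hu
    set w : Fin m → F := fun k => F.equivFin.symm ⟨2 * k + 1, by omega⟩ with hw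
    have hu_inj : Function.Injective fun k => (u k).1 := fun k l hkl => by
      have := F.equivFin.symm.injective (Subtype.ext hkl)
      simp only [Fin.mk.injEq] at this
      exact Fin.ext (by omega)
    have hw_inj : Function.Injective fun k => (w k).1 := fun k l hkl => by
      have := F.equivFin.symm.injective (Subtype.ext hkl)
      simp only [Fin.mk.injEq] at this
      exact Fin.ext (by omega)
    have huw : ∀ k, (u k).1 ≠ (w k).1 := fun k hk => by
      have := F.equivFin.symm.injective (Subtype.ext hk)
      simp only [Fin.mk.injEq] at this
      omega
    choose z hzD hz using fun k => hsep (u k).2 (w k).2 (huw k)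
    have hmaps : ∀ k ∈ (Finset.univ : Finset (Fin m)), (z k, (u k).1 (z k), (w k).1 (z k)) ∈
        D ×ˢ (Finset.range b ×ˢ Finset.range b) := fun k _ => by
      simp only [Finset.mem_product, Finset.mem_range]
      exact ⟨hzD k, hval _ (u k).2 _ (hzD k), hval _ (w k).2 _ (hzD k)⟩
    obtain ⟨⟨x, i, j⟩, hxij, hfib⟩ := Finset.exists_le_card_fiber_of_mul_le_card_of_maps_to
      (n := c ^ r) hmaps ⟨_, hmaps ⟨0, hm1⟩ (Finset.mem_univ _)⟩ (by
        simp only [Finset.card_product, Finset.card_range, Finset.card_univ, Fintype.card_fin, hm]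
        gcongr)
    simp only [Finset.mem_product, Finset.mem_range] at hxij
    obtain ⟨hxD, hi, hj⟩ := hxij
    set K := Finset.univ.filter fun k : Fin m =>
      (z k, (u k).1 (z k), (w k).1 (z k)) = (x, i, j) with hK
    have hKz : ∀ k ∈ K, z k = x ∧ (u k).1 x = i ∧ (w k).1 x = j := by
      intro k hk
      have := (Finset.mem_filter.1 hk).2
      simp only [Prod.mk.injEq] at this
      obtain ⟨rfl, h1, h2⟩ := this
      exact ⟨rfl, h1, h2⟩
    have hsub : ∀ v : Fin m → F, K.image (fun k => (v k).1) ⊆ F := fun v f hf => by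
      obtain ⟨k, -, rfl⟩ := Finset.mem_image.1 hf
      exact (v k).2
    have hrec : ∀ (v : Fin m → F) (l : ℕ), (Function.Injective fun k => (v k).1) →
        (∀ k ∈ K, (v k).1 x = l) →
        2 ^ r ≤ (levelShatterer (K.image fun k => (v k).1) (D.erase x) b).card := by
      intro v l hv hl
      refine ih _ _ ((Finset.card_le_card (Finset.erase_subset _ _)).trans hD)
        (fun f hf y hy => hval f (hsub v hf) y (Finset.mem_of_mem_erase hy)) ?_ ?_
      · intro f hf g hg hfg
        obtain ⟨y, hy, hfgy⟩ := hsep (hsub v hf) (hsub v hg) hfg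
        refine ⟨y, Finset.mem_erase.2 ⟨?_, hy⟩, hfgy⟩
        -- Within one half of the selected pairs all functions agree at `x`, so they must be
        -- separated at another point and `x` can be removed from the domain.
        rintro rfl
        obtain ⟨k, hk, rfl⟩ := Finset.mem_image.1 hf
        obtain ⟨k', hk', rfl⟩ := Finset.mem_image.1 hg
        have h1 := hl k hk
        have h2 := hl k' hk'
        omega
      · rwa [Finset.card_image_of_injective _ hv]
    have r1 := hrec u i hu_inj fun k hk => (hKz k hk).2.1
    have r2 := hrec w j hw_inj fun k hk => (hKz k hk).2.2
    have hv1 : ∀ f ∈ K.image (fun k => (u k).1), f x = i := fun f hf => by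
      obtain ⟨k, hk, rfl⟩ := Finset.mem_image.1 hf
      exact (hKz k hk).2.1
    have hv2 : ∀ f ∈ K.image (fun k => (w k).1), f x = j := fun f hf => by
      obtain ⟨k, hk, rfl⟩ := Finset.mem_image.1 hf
      exact (hKz k hk).2.2
    obtain ⟨k, hk⟩ := Finset.card_pos.1 (hc1.trans hfib)
    obtain ⟨h1, h2, h3⟩ := hKz k hk
    have hsepk := hz k
    rw [h1, h2, h3] at hsepk
    rw [pow_succ]
    rcases hsepk with h | h
    · have := card_levelShatterer_add_le (hsub u) (hsub w) hxD h hj hv1 hv2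
      omega
    · have := card_levelShatterer_add_le (hsub w) (hsub u) hxD h hi hv2 hv1
      omega

/-- The packing bound for integer-valued functions that shatter no large set. -/
lemma log_card_le_of_levelShatters {b n d : ℕ} (hb : 1 ≤ b) (hn : 1 ≤ n) (F : Finset (X → ℕ))
    (D : Finset X) (hD : D.card ≤ n) (hval : ∀ f ∈ F, ∀ x ∈ D, f x < b)
    (hsep : (F : Set (X → ℕ)).Pairwise fun f g => ∃ x ∈ D, f x + 2 ≤ g x ∨ g x + 2 ≤ f x)
    (hd : ∀ P, LevelShatters F P → P.card ≤ d) :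
    Real.log F.card ≤ (3 + 2 * d * Real.log (n * b)) * Real.log (2 * (n * (b * b))) := by
  have hn' : (1 : ℝ) ≤ n := by exact_mod_cast hn
  have hb' : (1 : ℝ) ≤ b := by exact_mod_cast hb
  have hnb : (1 : ℝ) ≤ n * b := by nlinarith
  have hl1 : 0 ≤ Real.log (n * b) := Real.log_nonneg hnb
  have hl2 : 0 ≤ Real.log (2 * (n * (b * b))) := Real.log_nonneg (by nlinarith)
  set A : ℝ := 1 + d * Real.log (n * b) with hA
  have hA0 : 1 ≤ A := by
    have : 0 ≤ (d : ℝ) * Real.log (n * b) := by positivity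
    linarith
  have hlog2 : 1 / 2 < Real.log 2 := by linarith [Real.log_two_gt_d9]
  -- If `F` had `(2 * n * b ^ 2) ^ r` elements, then counting the shattered sets with weight `1 / (n
  -- * b)` would give `r * log 2 ≤ A`, contradicting `r > 2 * A` and `log 2 > 1 / 2`.
  set r := ⌊2 * A⌋₊ + 1 with hr
  have hr1 : 2 * A < r := by
    rw [hr]
    push_cast
    exact Nat.lt_floor_add_one _
  have hr2 : (r : ℝ) ≤ 2 * A + 1 := by
    rw [hr]
    push_cast
    linarith [Nat.floor_le (by linarith : 0 ≤ 2 * A)]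
  rcases F.eq_empty_or_nonempty with rfl | hne
  · simp only [Finset.card_empty, Nat.cast_zero, Real.log_zero]
    positivity
  have hlt : F.card < (2 * (n * (b * b))) ^ r := by
    by_contra! hge
    have h1 := two_pow_le_card_levelShatterer hb hn r F D hD hval hsep hge
    have h2 := card_mul_pow_le (D ×ˢ Finset.range b) (levelShatterer F D b) (d := d)
      (c := 1 / (n * b)) (fun P hP => ⟨(mem_levelShatterer.1 hP).1,
        hd P (mem_levelShatterer.1 hP).2⟩) (by positivity) (by
          rw [div_le_one (by linarith)]
          exact hnb)
    have h3 : (1 : ℝ) / (n * b) * (D ×ˢ Finset.range b).card ≤ 1 := by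
      rw [Finset.card_product, Finset.card_range, one_div_mul_eq_div, div_le_one (by linarith)]
      push_cast
      gcongr
    have h4 : (2 : ℝ) ^ r * (1 / (n * b)) ^ d ≤ Real.exp 1 := by
      refine le_trans ?_ (h2.trans (Real.exp_le_exp.2 h3))
      gcongr
      exact_mod_cast h1
    have h5 := Real.log_le_log (by positivity) h4
    rw [Real.log_exp, Real.log_mul (by positivity) (by positivity), Real.log_pow, Real.log_pow,
      one_div, Real.log_inv] at h5
    nlinarith
  have h1 : Real.log F.card ≤ r * Real.log (2 * (n * (b * b))) := by
    rw [← Real.log_pow]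
    refine Real.log_le_log (by exact_mod_cast hne.card_pos) ?_
    exact_mod_cast hlt.le
  refine h1.trans ?_
  gcongr
  linarith

end Levels

/-! ### Classes of polynomial fat-shattering dimension -/

section Fat

variable {X : Type u} {H : Set (X → I)}

/-- The function `h`, rounded down to a multiple of `2⁻ʲ`. -/
def level (j : ℕ) (h : X → I) (x : X) : ℕ := ⌊(h x : ℝ) * 2 ^ j⌋₊

lemma level_lt (j : ℕ) (h : X → I) (x : X) : level j h x < 2 ^ j + 1 := by
  rw [level, Nat.floor_lt (mul_nonneg (h x).2.1 (by positivity))]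
  push_cast
  have := mul_le_mul_of_nonneg_right (h x).2.2 (by positivity : (0 : ℝ) ≤ 2 ^ j)
  linarith

/-- A real gap of two grid steps survives rounding as an integer gap of two, leaving a level
strictly between the two values. -/
lemma level_add_two_le {j : ℕ} {g h : X → I} {x : X}
    (hgh : 2 * (1 / 2) ^ j < (h x : ℝ) - g x) : level j g x + 2 ≤ level j h x := by
  rw [level, level, Nat.le_floor_iff (mul_nonneg (h x).2.1 (by positivity))]
  push_cast
  have h1 := Nat.floor_le (mul_nonneg (g x).2.1 (by positivity : (0 : ℝ) ≤ 2 ^ j))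
  have h2 := mul_lt_mul_of_pos_right hgh (by positivity : (0 : ℝ) < 2 ^ j)
  have h3 : 2 * (1 / 2) ^ j * (2 : ℝ) ^ j = 2 := by
    rw [mul_assoc, ← mul_pow]
    norm_num
  rw [h3] at h2
  linarith

-- Two levels over one point cannot be shattered independently, so projection to points loses
-- nothing. Rounded values at least `s + 1` or at most `s - 1` put the real value on either side of
-- `(s + 1 / 2) * 2⁻ʲ`, at distance at least `2⁻ʲ⁻¹`.
open scoped Classical in
lemma fatShatters_of_levelShatters {j : ℕ} {S : Finset H} {P : Finset (X × ℕ)}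
    (hP : LevelShatters (S.image fun h => level j h.1) P) :
    Set.InjOn Prod.fst (P : Set (X × ℕ)) ∧
      FatShatters H ((1 / 2) ^ (j + 1)) (P.image Prod.fst) := by
  have hinj : ∀ p ∈ P, ∀ q ∈ P, p.1 = q.1 → ¬ p.2 < q.2 := by
    intro p hp q hq hpq hlt
    obtain ⟨f, -, hf⟩ := hP {q} (by simpa using hq)
    have h1 := (hf q hq).1 (by simp)
    have h2 := (hf p hp).2 (by
      rw [Finset.mem_singleton]
      rintro rfl
      exact lt_irrefl _ hlt)
    rw [hpq] at h2
    omega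
  have hinj' : Set.InjOn Prod.fst (P : Set (X × ℕ)) := fun p hp q hq hpq =>
    Prod.ext hpq (le_antisymm (not_lt.1 (hinj q hq p hp hpq.symm)) (not_lt.1 (hinj p hp q hq hpq)))
  refine ⟨hinj', ?_⟩
  have hchoice : ∀ x, ∃ s : ℕ, x ∈ P.image Prod.fst → (x, s) ∈ P := by
    intro x
    by_cases hx : x ∈ P.image Prod.fst
    · obtain ⟨p, hp, rfl⟩ := Finset.mem_image.1 hx
      exact ⟨p.2, fun _ => hp⟩
    · exact ⟨0, fun h => absurd h hx⟩
  choose s hs using hchoice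
  refine ⟨fun x => (s x + 1 / 2) * (1 / 2) ^ j, fun E hE => ?_⟩
  obtain ⟨f, hf, hfP⟩ := hP (P.filter fun p => p.1 ∈ E) (Finset.filter_subset _ _)
  obtain ⟨h, -, rfl⟩ := Finset.mem_image.1 hf
  refine ⟨h.1, h.2, fun x hx => ?_⟩
  have hfx := hfP _ (hs x hx)
  have h0 : (0 : ℝ) ≤ h.1 x * 2 ^ j := mul_nonneg (h.1 x).2.1 (by positivity)
  have hpow : (h.1 x : ℝ) * 2 ^ j * (1 / 2) ^ j = h.1 x := by
    rw [mul_assoc, ← mul_pow]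
    norm_num
  constructor
  · intro hxE
    have h1 := hfx.1 (Finset.mem_filter.2 ⟨hs x hx, hxE⟩)
    simp only [level] at h1
    rw [Nat.le_floor_iff h0] at h1
    push_cast at h1
    have h2 := mul_le_mul_of_nonneg_right h1 (by positivity : (0 : ℝ) ≤ (1 / 2) ^ j)
    rw [hpow] at h2
    refine le_trans (le_of_eq ?_) h2
    ring
  · intro hxE
    have h1 := hfx.2 fun hmem => hxE (Finset.mem_filter.1 hmem).2
    simp only [level] at h1
    rw [Nat.succ_le_iff, Nat.floor_lt h0] at h1
    have h2 := mul_le_mul_of_nonneg_right h1.le (by positivity : (0 : ℝ) ≤ (1 / 2) ^ j)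
    rw [hpow] at h2
    refine h2.trans (le_of_eq ?_)
    ring

lemma card_le_of_fatShatters {α B : ℝ} (hB : 0 ≤ B)
    (hfat : (fatDim H α : ℝ≥0∞) ≤ ENNReal.ofReal B) {S : Finset X} (hS : FatShatters H α S) :
    (S.card : ℝ) ≤ B := by
  have h : (S.card : ℕ∞) ≤ fatDim H α := le_iSup₂_of_le S hS le_rfl
  have h1 : ((S.card : ℕ∞) : ℝ≥0∞) ≤ fatDim H α := by exact_mod_cast h
  have h2 := ENNReal.toReal_mono ENNReal.ofReal_ne_top (h1.trans hfat)
  rw [ENNReal.toReal_ofReal hB] at h2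
  simpa using h2

/-- The packing numbers of a class of bounded fat-shattering dimension. -/
lemma log_card_le_of_fatDim {j : ℕ} {B : ℝ} (hB : 0 ≤ B)
    (hfat : (fatDim H ((1 / 2) ^ (j + 1)) : ℝ≥0∞) ≤ ENNReal.ofReal B) {T : ℕ} (hT : 1 ≤ T)
    (x : Fin T → X) (S : Finset H)
    (hfar : (S : Set H).Pairwise fun g h =>
      (2 * √(T : ℝ) * (1 / 2) ^ j) ^ 2 < ∑ t, ((g.1 (x t) : ℝ) - h.1 (x t)) ^ 2) :
    Real.log S.card ≤ (3 + 2 * B * Real.log (T * (2 ^ j + 1))) *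
      Real.log (2 * (T * ((2 ^ j + 1) * (2 ^ j + 1)))) := by
  classical
  have hsep : ∀ g ∈ S, ∀ h ∈ S, g ≠ h → ∃ z ∈ Finset.univ.image x,
      level j g.1 z + 2 ≤ level j h.1 z ∨ level j h.1 z + 2 ≤ level j g.1 z := by
    intro g hg h hh hgh
    have h1 := hfar hg hh hgh
    by_contra! hno
    refine not_le.2 h1 ?_
    calc ∑ t, ((g.1 (x t) : ℝ) - h.1 (x t)) ^ 2 ≤ ∑ _t : Fin T, (2 * (1 / 2 : ℝ) ^ j) ^ 2 := by
          refine Finset.sum_le_sum fun t _ => ?_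
          obtain ⟨n1, n2⟩ := hno (x t) (Finset.mem_image_of_mem x (Finset.mem_univ t))
          refine sq_le_sq' ?_ ?_
          · by_contra! hlt
            have := level_add_two_le (j := j) (g := g.1) (h := h.1) (x := x t) (by linarith)
            omega
          · by_contra! hlt
            have := level_add_two_le (j := j) (g := h.1) (h := g.1) (x := x t) (by linarith)
            omega
      _ = (2 * √(T : ℝ) * (1 / 2) ^ j) ^ 2 := by
          have := Real.sq_sqrt (Nat.cast_nonneg T : (0 : ℝ) ≤ T)
          simp only [Finset.sum_const, Finset.card_univ, Fintype.card_fin, nsmul_eq_mul, mul_pow,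
            this]
          ring
  have hinj : Set.InjOn (fun h : H => level j h.1) S := by
    intro g hg h hh hgh
    by_contra hne
    obtain ⟨z, -, hz⟩ := hsep g hg h hh hne
    have := congrFun hgh z
    simp only at this
    omega
  rw [← Finset.card_image_of_injOn hinj]
  have hd : ∀ P, LevelShatters (S.image fun h : H => level j h.1) P → P.card ≤ ⌊B⌋₊ := by
    intro P hP
    obtain ⟨h1, h2⟩ := fatShatters_of_levelShatters hP
    rw [← Finset.card_image_of_injOn h1]
    exact Nat.le_floor (card_le_of_fatShatters hB hfat h2)
  have h := log_card_le_of_levelShatters (b := 2 ^ j + 1) (n := T) (Nat.le_add_left 1 _) hT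
    (S.image fun h : H => level j h.1) (Finset.univ.image x)
    (Finset.card_image_le.trans (by simp)) (fun f hf z _ => by
      obtain ⟨h, -, rfl⟩ := Finset.mem_image.1 hf
      exact level_lt j h.1 z) (fun f hf g hg hfg => by
      obtain ⟨f', hf', rfl⟩ := Finset.mem_image.1 hf
      obtain ⟨g', hg', rfl⟩ := Finset.mem_image.1 hg
      exact hsep f' hf' g' hg' fun h => hfg (by rw [h])) hd
  push_cast at h
  have hT' : (1 : ℝ) ≤ T := by exact_mod_cast hT
  have h2j : (1 : ℝ) ≤ 2 ^ j := one_le_pow₀ (by norm_num)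
  have hl1 : 0 ≤ Real.log (T * (2 ^ j + 1)) := Real.log_nonneg (by nlinarith)
  have hl2 : 0 ≤ Real.log (2 * (T * ((2 ^ j + 1) * (2 ^ j + 1)))) :=
    Real.log_nonneg (by nlinarith)
  refine h.trans ?_
  gcongr
  exact Nat.floor_le hB

/-- The scales that matter are those with `2ʲ ≤ 2 √T`. -/
lemma log_mul_two_pow_le {T j : ℕ} (hT : 1 ≤ T)
    (hj : j * Real.log 2 ≤ Real.log 2 + Real.log T / 2) :
    Real.log (T * (2 ^ j + 1)) ≤ 2 * (1 + Real.log T) ∧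
      Real.log (2 * (T * ((2 ^ j + 1) * (2 ^ j + 1)))) ≤ 5 * (1 + Real.log T) := by
  have hT' : (1 : ℝ) ≤ T := by exact_mod_cast hT
  have h2j : (1 : ℝ) ≤ 2 ^ j := one_le_pow₀ (by norm_num)
  have hlogT : 0 ≤ Real.log T := Real.log_nonneg hT'
  have hlog2 := Real.log_two_lt_d9
  have h1 : Real.log (2 ^ j + 1) ≤ j * Real.log 2 + Real.log 2 := by
    rw [← Real.log_pow, ← Real.log_mul (by positivity) (by norm_num)]
    exact Real.log_le_log (by positivity) (by linarith)
  rw [Real.log_mul (by positivity) (by positivity), Real.log_mul (by positivity) (by positivity),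
    Real.log_mul (by positivity) (by positivity), Real.log_mul (by positivity) (by positivity)]
  constructor <;> linarith

/-- The Rademacher complexity of a class of polynomial fat-shattering dimension. -/
lemma rademacher_le_of_fatDim {p : ℝ} (hp : 0 < p) (K : ℝ) :
    ∃ c : ℝ, 0 ≤ c ∧ ∀ (X : Type u) (H : Set (X → I)), H.Nonempty →
      (∀ α : ℝ, 0 < α → (fatDim H α : ℝ≥0∞) ≤ ENNReal.ofReal (K * α ^ (-p))) →
      ∀ T : ℕ, 1 ≤ T → rademacher H T ≤
        c * (T : ℝ) ^ max (1 / 2) ((p - 1) / p) * (1 + Real.log T) ^ 2 := by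
  -- `K' ≥ 1` lets lower-order constants be absorbed into the dimension bound, and `p' = max p 2`
  -- merges the two regimes into the exponent `1 - 1 / p'`.
  set K' := max K 1 with hK'
  have hK1 : 1 ≤ K' := le_max_right _ _
  set p' := max p 2 with hp'
  have hp2 : 2 ≤ p' := le_max_right _ _
  have hexp : max (1 / 2) ((p - 1) / p) = 1 - 1 / p' := by
    rcases le_total p 2 with h | h
    · rw [hp', max_eq_right h, max_eq_left]
      · norm_num
      · rw [div_le_div_iff₀ hp (by norm_num)]
        linarith
    · rw [hp', max_eq_left h, max_eq_right]
      · field_simp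
      · rw [div_le_div_iff₀ (by norm_num) hp]
        linarith
  rw [hexp]
  refine ⟨8 * √(35 * K') * 2 ^ p + 2, by positivity,
    fun X H hH hfat T hT => ?_⟩
  have := hH.to_subtype
  have hT' : (1 : ℝ) ≤ T := by exact_mod_cast hT
  have hlogT : 0 ≤ Real.log T := Real.log_nonneg hT'
  set Λ := 1 + Real.log T with hΛ
  have hΛ1 : 1 ≤ Λ := by linarith
  have hT0 : (0 : ℝ) < T := by linarith
  -- Chaining stops at scale `2⁻ᴶ < T ^ (-1 / p')`, where the residual `2 * T * 2⁻ᴶ` has the target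
  -- order `T ^ (1 - 1 / p')`.
  obtain ⟨n, hn1, hn2⟩ := exists_nat_pow_near (x := (T : ℝ) ^ (1 / p')) (y := 2)
    (Real.one_le_rpow hT' (by positivity)) (by norm_num)
  set J := n + 1 with hJ
  have hlog2 := Real.log_two_gt_d9
  have hnlog : n * Real.log 2 ≤ Real.log T / 2 := by
    have h1 := Real.log_le_log (by positivity) hn1
    rw [Real.log_pow, Real.log_rpow hT0] at h1
    refine h1.trans ?_
    rw [one_div_mul_eq_div]
    exact div_le_div_of_nonneg_left hlogT (by norm_num) hp2
  have hJΛ : (J : ℝ) ≤ Λ := by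
    rw [hJ]
    push_cast
    have : (0 : ℝ) ≤ n := Nat.cast_nonneg n
    nlinarith
  have hjlog : ∀ j ≤ J, j * Real.log 2 ≤ Real.log 2 + Real.log T / 2 := by
    intro j hj
    have : (j : ℝ) ≤ n + 1 := by exact_mod_cast hj
    nlinarith
  have hpow2 : ∀ j : ℕ, (0 : ℝ) < (2 : ℝ) ^ (p * j) := fun j => by positivity
  refine rademacher_le_of_forall (by positivity) fun x => ?_
  have hB : ∀ j : ℕ, (fatDim H ((1 / 2) ^ (j + 1)) : ℝ≥0∞) ≤
      ENNReal.ofReal (K' * 2 ^ (p * (j + 1 : ℕ))) := by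
    intro j
    refine (hfat _ (by positivity)).trans (ENNReal.ofReal_le_ofReal ?_)
    have e : ((1 / 2 : ℝ) ^ (j + 1)) ^ (-p) = 2 ^ (p * (j + 1 : ℕ)) := by
      rw [one_div, inv_pow, Real.inv_rpow (by positivity), Real.rpow_neg (by positivity), inv_inv,
        ← Real.rpow_natCast, ← Real.rpow_mul (by norm_num), mul_comm]
    rw [e]
    exact mul_le_mul_of_nonneg_right (le_max_left _ _) (by positivity)
  have hchain := signAvg_iSup_le_chaining (fun (h : H) t => (h.1 (x t) : ℝ))
    (fun h t => by rw [abs_of_nonneg (h.1 (x t)).2.1]; exact (h.1 (x t)).2.2)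
    (r := fun j => 2 * √(T : ℝ) * (1 / 2) ^ j)
    (ℓ := fun j => 35 * K' * Λ ^ 2 * 2 ^ (p * (j + 1 : ℕ)))
    (fun i j hij => mul_le_mul_of_nonneg_left
      (pow_le_pow_of_le_one (by norm_num) (by norm_num) hij) (by positivity))
    (fun j => by positivity)
    (fun i j hij => by
      dsimp only
      gcongr
      norm_num)
    (fun g h => by
      refine (Finset.sum_le_card_nsmul _ _ 1 fun t _ => ?_).trans ?_
      · rw [sq_le_one_iff_abs_le_one]
        exact abs_sub_le_one _ _
      · simp only [Finset.card_univ, Fintype.card_fin, nsmul_eq_mul, mul_one, pow_zero, mul_pow,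
          Real.sq_sqrt hT0.le]
        linarith)
    J (fun j hj => ?_)
  · refine hchain.trans ?_
    have hhalf : √(T : ℝ) * (T : ℝ) ^ (1 / 2 - 1 / p') = (T : ℝ) ^ (1 - 1 / p') := by
      rw [Real.sqrt_eq_rpow, ← Real.rpow_add hT0]
      congr 1
      ring
    have hterm : ∀ j ∈ Finset.range J, 4 * (2 * √(T : ℝ) * (1 / 2) ^ j) *
        √(35 * K' * Λ ^ 2 * 2 ^ (p * ((j + 1 : ℕ) + 1 : ℕ))) ≤
        8 * √(35 * K') * 2 ^ p * (T : ℝ) ^ (1 - 1 / p') * Λ := by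
      intro j hj
      have hjn : (j : ℝ) ≤ n := by
        have := Finset.mem_range.1 hj
        exact_mod_cast (by omega : j ≤ n)
      have h1 : √(35 * K' * Λ ^ 2 * 2 ^ (p * ((j + 1 : ℕ) + 1 : ℕ))) =
          √(35 * K') * Λ * (2 ^ p * 2 ^ (p / 2 * j)) := by
        rw [Real.sqrt_mul (by positivity), Real.sqrt_mul (by positivity),
          Real.sqrt_sq (by positivity), Real.sqrt_eq_rpow (2 ^ _),
          ← Real.rpow_mul (by norm_num), ← Real.rpow_add (by norm_num)]
        congr 2
        push_cast
        ring
      -- The terms grow with `j` for `p > 2` and decay for `p < 2`. Passing to `p'` and to the last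
      -- index `n` bounds both cases uniformly; the `J ≤ Λ` terms then cost a second logarithm.
      have h2 : (1 / 2 : ℝ) ^ j * 2 ^ (p / 2 * j) ≤ (T : ℝ) ^ (1 / 2 - 1 / p') := by
        have e1 : (1 / 2 : ℝ) ^ j * 2 ^ (p / 2 * j) = 2 ^ ((p / 2 - 1) * j) := by
          rw [one_div, inv_pow, ← Real.rpow_natCast, ← Real.rpow_neg (by norm_num),
            ← Real.rpow_add (by norm_num)]
          congr 1
          ring
        have e2 : (T : ℝ) ^ (1 / 2 - 1 / p') = ((T : ℝ) ^ (1 / p')) ^ (p' / 2 - 1) := by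
          rw [← Real.rpow_mul hT0.le]
          congr 1
          field_simp
        have hpp : p / 2 - 1 ≤ p' / 2 - 1 := by linarith [le_max_left p 2]
        have hp0 : 0 ≤ p' / 2 - 1 := by linarith
        rw [e1, e2]
        calc (2 : ℝ) ^ ((p / 2 - 1) * j) ≤ 2 ^ ((n : ℝ) * (p' / 2 - 1)) := by
              refine Real.rpow_le_rpow_of_exponent_le (by norm_num) ?_
              have hj0 : (0 : ℝ) ≤ j := Nat.cast_nonneg j
              nlinarith
          _ = ((2 : ℝ) ^ n) ^ (p' / 2 - 1) := by
              rw [Real.rpow_mul (by norm_num), Real.rpow_natCast]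
          _ ≤ ((T : ℝ) ^ (1 / p')) ^ (p' / 2 - 1) := by gcongr
      rw [h1, ← hhalf]
      calc 4 * (2 * √(T : ℝ) * (1 / 2) ^ j) * (√(35 * K') * Λ * (2 ^ p * 2 ^ (p / 2 * j)))
          = 8 * √(35 * K') * 2 ^ p * √(T : ℝ) * Λ * ((1 / 2) ^ j * 2 ^ (p / 2 * j)) := by ring
        _ ≤ 8 * √(35 * K') * 2 ^ p * √(T : ℝ) * Λ * (T : ℝ) ^ (1 / 2 - 1 / p') := by gcongr
        _ = _ := by ring
    have hlast : √(T : ℝ) * (2 * √(T : ℝ) * (1 / 2) ^ J) ≤ 2 * (T : ℝ) ^ (1 - 1 / p') := by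
      have e : √(T : ℝ) * (2 * √(T : ℝ) * (1 / 2) ^ J) = 2 * (T * (1 / 2) ^ J) := by
        have := Real.mul_self_sqrt hT0.le
        linear_combination 2 * (1 / 2 : ℝ) ^ J * this
      rw [e, Real.rpow_sub hT0, Real.rpow_one, one_div, inv_pow, ← div_eq_mul_inv]
      gcongr
    have hsum := Finset.sum_le_card_nsmul _ _ _ hterm
    rw [Finset.card_range, nsmul_eq_mul] at hsum
    have hpos : 0 ≤ 8 * √(35 * K') * 2 ^ p * (T : ℝ) ^ (1 - 1 / p') * Λ := by positivity
    have h3 := mul_le_mul_of_nonneg_right hJΛ hpos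
    have h4 : 2 * (T : ℝ) ^ (1 - 1 / p') ≤ 2 * (T : ℝ) ^ (1 - 1 / p') * Λ ^ 2 :=
      le_mul_of_one_le_right (by positivity) (one_le_pow₀ hΛ1)
    calc _ ≤ Λ * (8 * √(35 * K') * 2 ^ p * (T : ℝ) ^ (1 - 1 / p') * Λ) +
          2 * (T : ℝ) ^ (1 - 1 / p') * Λ ^ 2 := add_le_add (hsum.trans h3) (hlast.trans h4)
      _ = _ := by ring
  · have hpack : ∀ S : Finset H, (S : Set H).Pairwise (fun g h : H =>
        (2 * √(T : ℝ) * (1 / 2) ^ j) ^ 2 < ∑ t, ((g.1 (x t) : ℝ) - h.1 (x t)) ^ 2) →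
        Real.log S.card ≤ 35 * K' * Λ ^ 2 * 2 ^ (p * (j + 1 : ℕ)) := by
      intro S hS
      obtain ⟨l1, l2⟩ := log_mul_two_pow_le hT (hjlog j hj)
      set B := K' * (2 : ℝ) ^ (p * (j + 1 : ℕ)) with hBdef
      have hB1 : 1 ≤ B := by
        have : (1 : ℝ) ≤ 2 ^ (p * (j + 1 : ℕ)) := Real.one_le_rpow (by norm_num) (by positivity)
        nlinarith
      refine (log_card_le_of_fatDim (by linarith) (hB j) hT x S hS).trans ?_
      have h2j : (1 : ℝ) ≤ 2 ^ j := one_le_pow₀ (by norm_num)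
      have hl1 : 0 ≤ Real.log (T * (2 ^ j + 1)) := Real.log_nonneg (by nlinarith)
      have hl2 : 0 ≤ Real.log (2 * (T * ((2 ^ j + 1) * (2 ^ j + 1)))) :=
        Real.log_nonneg (by nlinarith)
      calc (3 + 2 * B * Real.log (T * (2 ^ j + 1))) *
            Real.log (2 * (T * ((2 ^ j + 1) * (2 ^ j + 1))))
          ≤ (3 + 2 * B * (2 * Λ)) * (5 * Λ) := by gcongr
        _ ≤ (7 * (B * Λ)) * (5 * Λ) := by
          have : 1 ≤ B * Λ := one_le_mul_of_one_le_of_one_le hB1 hΛ1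
          gcongr
          linarith
        _ = _ := by rw [hBdef]; ring
    obtain ⟨S, q, hS, hq⟩ := exists_cover_of_packing
      (fun g h : H => (2 * √(T : ℝ) * (1 / 2) ^ j) ^ 2 <
        ∑ t, ((g.1 (x t) : ℝ) - h.1 (x t)) ^ 2)
      (fun h => by simp only [sub_self]; simpa using sq_nonneg _)
      (fun g h hgh => by
        refine hgh.trans_le (le_of_eq (Finset.sum_congr rfl fun t _ => ?_))
        ring) (B := Real.exp (35 * K' * Λ ^ 2 * 2 ^ (p * (j + 1 : ℕ)))) (fun S hS => by
        rcases S.eq_empty_or_nonempty with rfl | hne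
        · simpa using (Real.exp_pos _).le
        · have : (0 : ℝ) < S.card := by exact_mod_cast hne.card_pos
          rw [← Real.exp_log this]
          exact Real.exp_le_exp.2 (hpack S hS))
    exact ⟨S, q, hpack S hS, fun i => ⟨(hq i).1, not_lt.1 (hq i).2⟩⟩

end Fat

/-! ### The three regret bounds -/

section Bounds

lemma exists_sum_two_pow_rpow_le {q : ℝ} (hq : 0 < q) : ∃ C : ℝ, 0 ≤ C ∧ ∀ T : ℕ, 1 ≤ T →
    ∑ i ∈ Finset.range (Nat.log 2 T + 1), ((2 ^ i : ℕ) : ℝ) ^ q ≤ C * (T : ℝ) ^ q := by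
  have h1 : 1 < (2 : ℝ) ^ q := Real.one_lt_rpow (by norm_num) hq
  have h0 : 0 < (2 : ℝ) ^ q - 1 := by linarith
  refine ⟨2 ^ q / (2 ^ q - 1), by positivity, fun T hT => ?_⟩
  have hpow : ∀ i : ℕ, ((2 ^ i : ℕ) : ℝ) ^ q = ((2 : ℝ) ^ q) ^ i := fun i => by
    rw [Nat.cast_pow, Nat.cast_ofNat, ← Real.rpow_natCast, ← Real.rpow_natCast,
      ← Real.rpow_mul (by norm_num), ← Real.rpow_mul (by norm_num), mul_comm]
  simp only [hpow]
  rw [geom_sum_eq h1.ne', div_mul_eq_mul_div]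
  gcongr
  have h2 : ((2 : ℝ) ^ q) ^ Nat.log 2 T ≤ (T : ℝ) ^ q := by
    rw [← hpow]
    gcongr
    exact Nat.pow_log_le_self 2 (by omega)
  rw [pow_succ']
  have := mul_le_mul_of_nonneg_left h2 (by positivity : 0 ≤ (2 : ℝ) ^ q)
  linarith

/-- The bound is linear in `K` with `C` depending only on `q`; applied with `K = 33 * √d`, it gives
an absolute constant for VC classes. -/
lemma obliviousRegret_le_of_rademacher_le {q : ℝ} (hq : 0 < q) : ∃ C : ℝ, 0 ≤ C ∧
    ∀ (X : Type u) [MeasurableSpace X] (H : Set (X → I)), H.Nonempty → MeasurableERM H →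
      ∀ K : ℝ, (∀ T : ℕ, 1 ≤ T → rademacher H T ≤ K * (T : ℝ) ^ q) → 0 ≤ K →
      ∀ T : ℕ, 1 ≤ T →
        obliviousRegret H (Playout.program.rule H) T ≤ ((C * K * (T : ℝ) ^ q : ℝ) : EReal) := by
  obtain ⟨C, hC, hsum⟩ := exists_sum_two_pow_rpow_le hq
  refine ⟨C, hC, fun X _ H hH hM K hK hK0 T hT => ?_⟩
  refine (obliviousRegret_program_le hH hM hT).trans (EReal.coe_le_coe_iff.2 ?_)
  calc ∑ i ∈ Finset.range (Nat.log 2 T + 1), rademacher H (2 ^ i)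
      ≤ ∑ i ∈ Finset.range (Nat.log 2 T + 1), K * ((2 ^ i : ℕ) : ℝ) ^ q :=
        Finset.sum_le_sum fun i _ => hK _ Nat.one_le_two_pow
    _ = K * ∑ i ∈ Finset.range (Nat.log 2 T + 1), ((2 ^ i : ℕ) : ℝ) ^ q := by
        rw [Finset.mul_sum]
    _ ≤ K * (C * (T : ℝ) ^ q) := by gcongr; exact hsum T hT
    _ = C * K * (T : ℝ) ^ q := by ring

lemma obliviousRegret_le_of_vcDim : ∃ c : ℝ,
    ∀ (X : Type u) [MeasurableSpace X] (H : Set (X → I)), H.Nonempty → MeasurableERM H →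
      IsBinary H → ∀ d : ℕ, vcDim H = d → ∀ T : ℕ, 1 ≤ T →
        obliviousRegret H (Playout.program.rule H) T ≤ ((c * √((d : ℝ) * T) : ℝ) : EReal) := by
  obtain ⟨C, -, h⟩ := obliviousRegret_le_of_rademacher_le.{u} (q := 1 / 2) (by norm_num)
  refine ⟨C * 33, fun X _ H hH hM hb d hd T hT => ?_⟩
  refine (h X H hH hM (33 * √(d : ℝ)) (fun T hT => ?_) (by positivity) T hT).trans (le_of_eq ?_)
  · refine (rademacher_le_of_vcDim hH hb hd hT).trans (le_of_eq ?_)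
    rw [← Real.sqrt_eq_rpow, Real.sqrt_mul (Nat.cast_nonneg d), mul_assoc]
  · rw [← Real.sqrt_eq_rpow, Real.sqrt_mul (Nat.cast_nonneg d)]
    ring_nf

/-- Two logarithms come from chaining. The third is the number of epochs, each bounded by the value
at `T`. -/
lemma obliviousRegret_le_of_fatDim {p : ℝ} (hp : 0 < p) (K : ℝ) : ∃ c : ℝ,
    ∀ (X : Type u) [MeasurableSpace X] (H : Set (X → I)), H.Nonempty → MeasurableERM H →
      (∀ α : ℝ, 0 < α → (fatDim H α : ℝ≥0∞) ≤ ENNReal.ofReal (K * α ^ (-p))) →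
      ∀ T : ℕ, 2 ≤ T → obliviousRegret H (Playout.program.rule H) T ≤
        ((c * (T : ℝ) ^ max (1 / 2) ((p - 1) / p) * Real.log T ^ 3 : ℝ) : EReal) := by
  obtain ⟨c, hc, h⟩ := rademacher_le_of_fatDim.{u} hp K
  refine ⟨c * 27, fun X _ H hH hM hfat T hT => ?_⟩
  refine (obliviousRegret_program_le hH hM (by omega)).trans (EReal.coe_le_coe_iff.2 ?_)
  set e := max (1 / 2) ((p - 1) / p) with he
  have he0 : 0 ≤ e := le_trans (by norm_num) (le_max_left _ _)
  have hT' : (2 : ℝ) ≤ T := by exact_mod_cast hT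
  have hlog : Real.log 2 ≤ Real.log T := Real.log_le_log (by norm_num) hT'
  have hlog2 := Real.log_two_gt_d9
  have h1 : 1 + Real.log T ≤ 3 * Real.log T := by linarith
  have h2 : ((Nat.log 2 T + 1 : ℕ) : ℝ) ≤ 3 * Real.log T := by
    have h3 : (Nat.log 2 T : ℝ) * Real.log 2 ≤ Real.log T := by
      rw [← Real.log_pow]
      refine Real.log_le_log (by positivity) ?_
      exact_mod_cast Nat.pow_log_le_self 2 (by omega)
    push_cast
    have : (0 : ℝ) ≤ Nat.log 2 T := Nat.cast_nonneg _
    nlinarith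
  have hterm : ∀ i ∈ Finset.range (Nat.log 2 T + 1), rademacher H (2 ^ i) ≤
      c * (T : ℝ) ^ e * (3 * Real.log T) ^ 2 := by
    intro i hi
    have hi' : 2 ^ i ≤ T := (Nat.pow_le_pow_right (by norm_num)
      (Nat.lt_succ_iff.1 (Finset.mem_range.1 hi))).trans (Nat.pow_log_le_self 2 (by omega))
    have hi1 : ((2 ^ i : ℕ) : ℝ) ≤ T := by exact_mod_cast hi'
    have hi0 : (1 : ℝ) ≤ ((2 ^ i : ℕ) : ℝ) := by exact_mod_cast Nat.one_le_two_pow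
    have hl0 : 0 ≤ Real.log ((2 ^ i : ℕ) : ℝ) := Real.log_nonneg hi0
    have hl1 : Real.log ((2 ^ i : ℕ) : ℝ) ≤ Real.log T := Real.log_le_log (by linarith) hi1
    refine (h X H hH hfat (2 ^ i) Nat.one_le_two_pow).trans ?_
    gcongr
    linarith
  have hl0 : 0 ≤ Real.log T := by linarith
  calc ∑ i ∈ Finset.range (Nat.log 2 T + 1), rademacher H (2 ^ i)
      ≤ ((Nat.log 2 T + 1 : ℕ) : ℝ) * (c * (T : ℝ) ^ e * (3 * Real.log T) ^ 2) := by
        refine (Finset.sum_le_card_nsmul _ _ _ hterm).trans (le_of_eq ?_)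
        rw [Finset.card_range, nsmul_eq_mul]
    _ ≤ (3 * Real.log T) * (c * (T : ℝ) ^ e * (3 * Real.log T) ^ 2) := by gcongr
    _ = c * 27 * (T : ℝ) ^ e * Real.log T ^ 3 := by ring

end Bounds

end HybridOnline

end

theorem theoremF1 :
    ∃ P : Program,
      Program.OracleEfficient.{u} P ∧ Program.FewOracleCalls.{u} P ∧
      (∀ (X : Type u) [MeasurableSpace X] (H : Set (X → I)), H.Nonempty → MeasurableERM H →
        RegretExists H (P.rule H)) ∧
      (∀ q : ℝ, 1 / 2 ≤ q → q ≤ 1 → ∀ K : ℝ, ∃ c : ℝ,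
        ∀ (X : Type u) [MeasurableSpace X] (H : Set (X → I)), H.Nonempty → MeasurableERM H →
          (∀ T : ℕ, 1 ≤ T → rademacher H T ≤ K * (T : ℝ) ^ q) →
          ∀ T : ℕ, 1 ≤ T → obliviousRegret H (P.rule H) T ≤ ((c * (T : ℝ) ^ q : ℝ) : EReal)) ∧
      (∃ c : ℝ,
        ∀ (X : Type u) [MeasurableSpace X] (H : Set (X → I)), H.Nonempty → MeasurableERM H →
          IsBinary H → ∀ d : ℕ, vcDim H = d →
          ∀ T : ℕ, 1 ≤ T → obliviousRegret H (P.rule H) T ≤ ((c * √((d : ℝ) * T) : ℝ) : EReal)) ∧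
      (∀ p : ℝ, 0 < p → ∃ k : ℕ, ∀ K : ℝ, ∃ c : ℝ,
        ∀ (X : Type u) [MeasurableSpace X] (H : Set (X → I)), H.Nonempty → MeasurableERM H →
          (∀ α : ℝ, 0 < α → (fatDim H α : ℝ≥0∞) ≤ ENNReal.ofReal (K * α ^ (-p))) →
          ∀ T : ℕ, 2 ≤ T → obliviousRegret H (P.rule H) T ≤
            ((c * (T : ℝ) ^ max (1 / 2) ((p - 1) / p) * Real.log T ^ k : ℝ) : EReal)) := by
  refine ⟨Playout.program, oracleEfficient_program, fewOracleCalls_program,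
    fun X _ H hH hM => regretExists_program hH hM, fun q hq _ K => ?_,
    obliviousRegret_le_of_vcDim, fun p hp => ⟨3, fun K => obliviousRegret_le_of_fatDim hp K⟩⟩
  obtain ⟨C, -, h⟩ := obliviousRegret_le_of_rademacher_le.{u} (q := q) (by linarith)
  -- The positive part of `K` supplies the nonnegative factor required for summing over epochs.
  refine ⟨C * max K 0, fun X _ H hH hM hK =>
    h X H hH hM (max K 0) (fun T hT => (hK T hT).trans ?_) (le_max_right _ _)⟩
  gcongr
  exact le_max_left _ _
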